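/- Let $G$ be a compact Lie group acting smoothly and isometrically on a closed (compact, without boundary) Riemannian manifold $M$ and by unitary maps on a $G$-equivariant Hermitian vector bundle $E\to M$. Let $\mathcal H=L^2(M,E)$ (with respect to the Riemannian volume), on which $G$ acts unitarily by $(gs)(x)=g\,s(g^{-1}x)$, and let $M_\phi$ denote multiplication by a function $\phi\in C(M)$. Let $$\Psi_M(\mathcal H)=\{P\in\mathcal L(\mathcal H)\;:\; M_\phi PM_\psi \text{ is compact for all } \phi,\psi\in C(M)\text{ with disjoint supports}\},$$ and let $\Psi^G_M(\mathcal H)$ be the set of those $P\in\Psi_M(\mathcal H)$ that commute with the action of $G$. For a clopen set $S\subset M$ regard $L^2(S,E)$ as a closed subspace of $\mathcal H$ (extension by zero), and let $\Psi_S(\mathcal H)$ be the set of $P\in\mathcal L(\mathcal H)$ that take values in $L^2(S,E)$, vanish on $L^2(M\smallsetminus S,E)$, and are such that $M_\phi PM_\psi$ is compact for all $\phi,\psi\in C(S)$ (extended by zero) with disjoint supports. For a finite-dimensional irreducible unitary representation $\alpha$ of $G$ and a closed $G$-invariant subspace $N\subset\mathcal H$ let $N_\alpha$ be its $\alpha$-isotypical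 component, and for a bounded $G$-invariant operator $T$ mapping $N$ to itself let $\pi_\alpha(T)$ on $N_\alpha$ be the restriction $T|_{N_\alpha}:N_\alpha\to N_\alpha$. Let $\mathcal P=\{x\in M : (T^*_GM)_x=\{0\}\}$, where $(T^*_GM)_x$ is the space of covectors $\xi\in T_x^*M$ vanishing on the tangent space at $x$ of the orbit $Gx$, i.e. $\xi(Y_M(x))=0$ for all $Y\in\operatorname{Lie}(G)$, with $Y_M(x)=\frac{d}{dt}\big|_{t=0}e^{tY}x$. Then $\mathcal P$ is clopen in $M$. Let $\chi$ be the characteristic function of $M\smallsetminus\mathcal P$. 1. For every $P\in\Psi_M(\mathcal H)$ we have $P=P_1+P_2+P_3$, where $P_1=M_\chi PM_\chi\in\Psi_{M\smallsetminus\mathcal P}(\mathcal H)$, $P_2=M_{1-\chi}PM_{1-\chi}\in\Psi_{\mathcal P}(\mathcal H)$ and $P_3=M_\chi PM_{1-\chi}+M_{1-\chi}PM_\chi$ is compact. 2. If $P\in\Psi_M^G(\mathcal H)$, then $P_1$ and $P_2$ are $G$-invariant and, for every $\alpha$ as above, $L^2(\mathcal P,E)_\alpha$ is finite-dimensional, so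 that $\pi_\alpha(P_2)$ is Fredholm as an operator on $L^2(\mathcal P,E)_\alpha$; moreover $\pi_\alpha(P)$ is Fredholm on $\mathcal H_\alpha$ if and only if $\pi_\alpha(P_1)$ is Fredholm, where $\pi_\alpha(P_1)$ may be regarded equivalently as an operator on $\mathcal H_\alpha$ or on $L^2(M\smallsetminus\mathcal P,E)_\alpha$. -/

import Mathlib

open Bundle Manifold MeasureTheory
open scoped ContDiff NNReal Topology

noncomputable section

/-! ### The Riemannian volume -/

/-- The Riemannian volume measure of an `n`-dimensional Riemannian manifold: the `n`-dimensional
Hausdorff measure of the Riemannian distance, normalised so as to give Lebesgue measure on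
`EuclideanSpace ℝ (Fin n)`. -/
abbrev riemannianVolume (n : ℕ) (M : Type*) [EMetricSpace M] [MeasurableSpace M] [BorelSpace M] :
    Measure M :=
  μHE[n]

section Volume
open Set Metric

theorem isContinuousRiemannianBundle_tangent (n : ℕ) (M : Type*) [TopologicalSpace M]
    [ChartedSpace (EuclideanSpace ℝ (Fin n)) M]
    [IsManifold (𝓡 n) ∞ M] [RiemannianBundle (fun x : M => TangentSpace (𝓡 n) x)]
    [h : IsContMDiffRiemannianBundle (𝓡 n) ∞ (EuclideanSpace ℝ (Fin n))
      (fun x : M => TangentSpace (𝓡 n) x)] :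
    IsContinuousRiemannianBundle (EuclideanSpace ℝ (Fin n))
      (fun x : M => TangentSpace (𝓡 n) x) := by
  obtain ⟨g, hg, hg'⟩ := h.exists_contMDiff
  exact ⟨g, hg.continuous, hg'⟩

attribute [local instance] normedAddCommGroupTangentSpaceVectorSpace
  normedSpaceTangentSpaceVectorSpace

theorem exists_nhds_volume_lt_top {n : ℕ} {M : Type*} [EMetricSpace M]
    [ChartedSpace (EuclideanSpace ℝ (Fin n)) M]
    [IsManifold (𝓡 n) ∞ M] [RiemannianBundle (fun x : M => TangentSpace (𝓡 n) x)]
    [IsContMDiffRiemannianBundle (𝓡 n) ∞ (EuclideanSpace ℝ (Fin n))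
      (fun x : M => TangentSpace (𝓡 n) x)]
    [IsRiemannianManifold (𝓡 n) M] [MeasurableSpace M] [BorelSpace M] (x : M) :
    ∃ U ∈ 𝓝 x, riemannianVolume n M U < ⊤ := by
  have := isContinuousRiemannianBundle_tangent n M
  rcases eventually_enorm_mfderivWithin_symm_extChartAt_lt (𝓡 n) x with ⟨C, C_pos, hC⟩
  let D (y : EuclideanSpace ℝ (Fin n)) :
      EuclideanSpace ℝ (Fin n) →L[ℝ] TangentSpace (𝓡 n) ((extChartAt (𝓡 n) x).symm y) :=
    mfderivWithin (𝓡 n) (𝓡 n) (extChartAt (𝓡 n) x).symm (range (𝓡 n)) y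
  have hD : ∀ᶠ y in 𝓝[range (𝓡 n)] (extChartAt (𝓡 n) x x), ‖D y‖ₑ < C := by
    exact hC
  clear hC
  obtain ⟨r, r_pos, hr⟩ : ∃ r > 0,
      ball (extChartAt (𝓡 n) x x) r ∩ range (𝓡 n) ⊆ (extChartAt (𝓡 n) x).target ∩
        {y | ‖D y‖ₑ < C} :=
    mem_nhdsWithin_iff.1 (Filter.inter_mem (extChartAt_target_mem_nhdsWithin x) hD)
  have hrange : range (𝓡 n) = univ := (𝓡 n).range_eq_univ
  rw [hrange, inter_univ] at hr
  have key : LipschitzOnWith C (extChartAt (𝓡 n) x).symm (ball (extChartAt (𝓡 n) x x) r) := by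
    intro p hp q hq
    let η := ContinuousAffineMap.lineMap (R := ℝ) p q
    set γ := (extChartAt (𝓡 n) x).symm ∘ η with hγ
    have hη : Icc 0 1 ⊆ ⇑η ⁻¹' ((extChartAt (𝓡 n) x).target ∩
        {y | ‖D y‖ₑ < C}) := by
      simp only [← image_subset_iff, ContinuousAffineMap.coe_lineMap_eq,
        ← segment_eq_image_lineMap, η]
      exact Subset.trans ((convex_ball _ _).segment_subset hp hq) hr
    simp only [preimage_inter, subset_inter_iff] at hη
    have η_smooth : ContMDiffOn 𝓘(ℝ, ℝ) (𝓡 n) 1 η (Icc 0 1) := by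
      apply ContMDiff.contMDiffOn
      rw [contMDiff_iff_contDiff]
      exact ContinuousAffineMap.contDiff _
    rw [IsRiemannianManifold.out (I := 𝓡 n)]
    have h1 : riemannianEDist (𝓡 n) ((extChartAt (𝓡 n) x).symm p) ((extChartAt (𝓡 n) x).symm q)
        ≤ pathELength (𝓡 n) γ 0 1 := by
      apply riemannianEDist_le_pathELength _ _ _ zero_le_one
      · exact (contMDiffOn_extChartAt_symm x).comp η_smooth hη.1
      · simp [γ, η, ContinuousAffineMap.coe_lineMap_eq]
      · simp [γ, η, ContinuousAffineMap.coe_lineMap_eq]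
    apply h1.trans
    rw [← lintegral_fderiv_lineMap_eq_edist, pathELength_eq_lintegral_mfderivWithin_Icc,
      ← lintegral_const_mul' _ _ ENNReal.coe_ne_top]
    apply setLIntegral_mono' measurableSet_Icc (fun t ht ↦ ?_)
    have h2 : mfderivWithin 𝓘(ℝ, ℝ) (𝓡 n) γ (Icc 0 1) t =
        (mfderivWithin (𝓡 n) (𝓡 n) (extChartAt (𝓡 n) x).symm (range (𝓡 n)) (η t)) ∘L (mfderivWithin 𝓘(ℝ, ℝ) (𝓡 n) η (Icc 0 1) t) := by
      apply mfderivWithin_comp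
      · exact mdifferentiableWithinAt_extChartAt_symm (hη.1 ht)
      · exact η_smooth.mdifferentiableOn one_ne_zero t ht
      · exact hη.1.trans (preimage_mono (extChartAt_target_subset_range x))
      · rw [uniqueMDiffWithinAt_iff_uniqueDiffWithinAt]
        exact uniqueDiffOn_Icc zero_lt_one t ht
    have h3 : mfderivWithin 𝓘(ℝ, ℝ) (𝓡 n) γ (Icc 0 1) t 1 = (mfderivWithin (𝓡 n) (𝓡 n) (extChartAt (𝓡 n) x).symm (range (𝓡 n)) (η t))
        (mfderivWithin 𝓘(ℝ, ℝ) (𝓡 n) η (Icc 0 1) t 1) := congr($h2 1)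
    rw [h3]
    apply (ContinuousLinearMap.le_opENorm _ _).trans
    gcongr
    · exact (hη.2 ht).le
    · simp only [mfderivWithin_eq_fderivWithin]
      exact le_of_eq rfl
  refine ⟨(extChartAt (𝓡 n) x).symm '' ball (extChartAt (𝓡 n) x x) r, ?_, ?_⟩
  · have h4 : (extChartAt (𝓡 n) x).source ∩
        extChartAt (𝓡 n) x ⁻¹' ball (extChartAt (𝓡 n) x x) r ∈ 𝓝 x :=
      Filter.inter_mem (extChartAt_source_mem_nhds x)
        ((continuousAt_extChartAt x).preimage_mem_nhds (ball_mem_nhds _ r_pos))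
    filter_upwards [h4] with y hy
    exact ⟨_, hy.2, (extChartAt (𝓡 n) x).left_inv hy.1⟩
  · have h5 := key.hausdorffMeasure_image_le (d := (n : ℝ)) (by positivity)
    have h6 : (μH[(n : ℝ)] : Measure (EuclideanSpace ℝ (Fin n)))
        (ball (extChartAt (𝓡 n) x x) r) < ⊤ := measure_ball_lt_top
    rw [riemannianVolume, Measure.euclideanHausdorffMeasure_def, Measure.smul_apply]
    refine ENNReal.mul_lt_top ENNReal.coe_lt_top (h5.trans_lt (ENNReal.mul_lt_top ?_ h6))
    simp

instance isFiniteMeasure_riemannianVolume {n : ℕ} {M : Type*} [EMetricSpace M]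
    [ChartedSpace (EuclideanSpace ℝ (Fin n)) M]
    [IsManifold (𝓡 n) ∞ M] [RiemannianBundle (fun x : M => TangentSpace (𝓡 n) x)]
    [IsContMDiffRiemannianBundle (𝓡 n) ∞ (EuclideanSpace ℝ (Fin n))
      (fun x : M => TangentSpace (𝓡 n) x)]
    [IsRiemannianManifold (𝓡 n) M] [MeasurableSpace M] [BorelSpace M] [CompactSpace M] :
    IsFiniteMeasure (riemannianVolume n M) := by
  refine ⟨isCompact_univ.measure_lt_top_of_nhdsWithin fun x _ => ?_⟩
  obtain ⟨U, hU, h⟩ := exists_nhds_volume_lt_top (n := n) x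
  exact ⟨U, mem_nhdsWithin_of_mem_nhds hU, h⟩

instance smulInvariantMeasure_riemannianVolume {n : ℕ} {G M : Type*} [Group G] [EMetricSpace M]
    [MeasurableSpace M] [BorelSpace M]
    [MulAction G M] [IsIsometricSMul G M] : SMulInvariantMeasure G M (riemannianVolume n M) where
  measure_preimage_smul g _ hs :=
    ((IsometryEquiv.constSMul g).measurePreserving_euclideanHausdorffMeasure n).measure_preimage
      hs.nullMeasurableSet

end Volume

/-! ### Hermitian vector bundles with a group action -/

/-- The scalar products on the fibres of a complex vector bundle form a (continuous) Hermitian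
metric. By polarization, it is enough to ask that the norm be continuous on the total space. -/
class IsHermitianBundle {M : Type*} [TopologicalSpace M] (F : Type*) [NormedAddCommGroup F]
    [NormedSpace ℂ F] (E : M → Type*) [∀ x, NormedAddCommGroup (E x)]
    [∀ x, InnerProductSpace ℂ (E x)] [TopologicalSpace (TotalSpace F E)] : Prop where
  continuous_norm : Continuous fun v : TotalSpace F E => ‖v.2‖

/-- A continuous action of `G` on a Hermitian vector bundle `E → M` covering the action of `G`
on `M`, by unitary maps between the fibres. -/
structure HermitianAction (G : Type*) [Group G] [TopologicalSpace G] {M : Type*} [MulAction G M]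
    (F : Type*) (E : M → Type*) [∀ x, NormedAddCommGroup (E x)]
    [∀ x, InnerProductSpace ℂ (E x)] [TopologicalSpace (TotalSpace F E)] where
  /-- The map `E x → E (g • x)`, `v ↦ g v`. -/
  act (g : G) (x : M) : E x ≃ₗᵢ[ℂ] E (g • x)
  one_act (x : M) (v : E x) :
    (⟨(1 : G) • x, act 1 x v⟩ : TotalSpace F E) = ⟨x, v⟩
  mul_act (g h : G) (x : M) (v : E x) :
    (⟨(g * h) • x, act (g * h) x v⟩ : TotalSpace F E) = ⟨g • h • x, act g (h • x) (act h x v)⟩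
  continuous_act : Continuous fun p : G × TotalSpace F E =>
    (⟨p.1 • p.2.1, act p.1 p.2.1 p.2.2⟩ : TotalSpace F E)

/-! ### Square integrable sections -/

section Sections

variable {M : Type*} [TopologicalSpace M] (F : Type*) [NormedAddCommGroup F] [NormedSpace ℂ F]
  (E : M → Type*) [∀ x, NormedAddCommGroup (E x)] [∀ x, InnerProductSpace ℂ (E x)]
  [TopologicalSpace (TotalSpace F E)] [FiberBundle F E] [VectorBundle ℂ F E]

variable {F E} in
theorem continuous_section_smul_add {s t : ∀ x, E x} {φ : M → ℂ} (hφ : Continuous φ)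
    (hs : Continuous fun x => (⟨x, s x⟩ : TotalSpace F E))
    (ht : Continuous fun x => (⟨x, t x⟩ : TotalSpace F E)) :
    Continuous fun x => (⟨x, φ x • s x + t x⟩ : TotalSpace F E) := by
  rw [continuous_iff_continuousAt] at *
  intro x
  have hs' := ((FiberBundle.continuousAt_totalSpace F _).1 (hs x)).2
  have ht' := ((FiberBundle.continuousAt_totalSpace F _).1 (ht x)).2
  refine (FiberBundle.continuousAt_totalSpace F _).2 ⟨continuousAt_id, ?_⟩
  refine (((hφ x).smul hs').add ht').congr ?_
  filter_upwards [(trivializationAt F E x).open_baseSet.mem_nhds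
    (mem_baseSet_trivializationAt F E x)] with y hy
  have := (trivializationAt F E x).linear ℂ hy
  simp [this.map_add, this.map_smul]

theorem continuous_zero_section : Continuous fun x => (⟨x, 0⟩ : TotalSpace F E) := by
  rw [continuous_iff_continuousAt]
  intro x
  refine (FiberBundle.continuousAt_totalSpace F _).2 ⟨continuousAt_id, ?_⟩
  refine (continuousAt_const (y := (0 : F))).congr ?_
  filter_upwards [(trivializationAt F E x).open_baseSet.mem_nhds
    (mem_baseSet_trivializationAt F E x)] with y hy
  exact ((trivializationAt F E x).linear ℂ hy).map_zero.symm

/-- The space of continuous sections of `E`. -/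
def continuousSections : Submodule ℂ (∀ x, E x) where
  carrier := {s | Continuous fun x => (⟨x, s x⟩ : TotalSpace F E)}
  zero_mem' := continuous_zero_section F E
  add_mem' {s t} hs ht := by
    simpa using continuous_section_smul_add (φ := fun _ => 1) continuous_const hs ht
  smul_mem' c s hs := by
    simpa using continuous_section_smul_add (φ := fun _ => c) continuous_const hs
      (continuous_zero_section F E)

variable {F E} in
theorem continuous_inner_section [IsHermitianBundle F E] {s t : ∀ x, E x}
    (hs : s ∈ continuousSections F E) (ht : t ∈ continuousSections F E) :
    Continuous fun x => inner ℂ (s x) (t x) := by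
  have key : ∀ r ∈ continuousSections F E, Continuous fun x => ‖r x‖ := fun r hr =>
    (IsHermitianBundle.continuous_norm (F := F) (E := E)).comp hr
  have h1 := key _ (add_mem hs ht)
  have h2 := key _ (sub_mem hs ht)
  have h3 := key _ (sub_mem hs (Submodule.smul_mem _ Complex.I ht))
  have h4 := key _ (add_mem hs (Submodule.smul_mem _ Complex.I ht))
  simp only [inner_eq_sum_norm_sq_div_four]
  simp only [Pi.add_apply, Pi.sub_apply, Pi.smul_apply] at h1 h2 h3 h4
  simp only [RCLike.I_to_complex, Complex.coe_algebraMap]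
  fun_prop

end Sections

section L2

variable {M : Type*} [TopologicalSpace M] [CompactSpace M] [MeasurableSpace M] [BorelSpace M]
  (μ : Measure M) [IsFiniteMeasure μ]
  (F : Type*) [NormedAddCommGroup F] [NormedSpace ℂ F]
  (E : M → Type*) [∀ x, NormedAddCommGroup (E x)] [∀ x, InnerProductSpace ℂ (E x)]
  [TopologicalSpace (TotalSpace F E)] [FiberBundle F E] [VectorBundle ℂ F E]

/-- The space of continuous sections, to be equipped with the `L²` scalar product. -/
def PreL2 (_μ : Measure M) (F : Type*) [NormedAddCommGroup F] [NormedSpace ℂ F]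
    (E : M → Type*) [∀ x, NormedAddCommGroup (E x)] [∀ x, InnerProductSpace ℂ (E x)]
    [TopologicalSpace (TotalSpace F E)] [FiberBundle F E] [VectorBundle ℂ F E] : Type _ :=
  continuousSections F E

instance : AddCommGroup (PreL2 μ F E) := inferInstanceAs (AddCommGroup (continuousSections F E))

instance : Module ℂ (PreL2 μ F E) := inferInstanceAs (Module ℂ (continuousSections F E))

namespace PreL2

variable {μ F E} in
/-- The section underlying an element of `PreL2 μ F E`. -/
def toFun : PreL2 μ F E →ₗ[ℂ] (∀ x, E x) := (continuousSections F E).subtype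

variable [IsHermitianBundle F E]

variable {μ F E} in
theorem continuous_inner_toFun (s t : PreL2 μ F E) :
    Continuous fun x => inner ℂ (s.toFun x) (t.toFun x) :=
  continuous_inner_section (F := F) s.2 t.2

variable {μ F E} in
theorem integrable_inner (s t : PreL2 μ F E) :
    Integrable (fun x => inner ℂ (s.toFun x) (t.toFun x)) μ :=
  (continuous_inner_toFun s t).integrable_of_hasCompactSupport (HasCompactSupport.of_compactSpace _)

/-- The `L²` scalar product `⟪s, t⟫ = ∫ ⟪s x, t x⟫ dμ(x)` on continuous sections. -/
abbrev core : PreInnerProductSpace.Core ℂ (PreL2 μ F E) where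
  inner s t := ∫ x, inner ℂ (s.toFun x) (t.toFun x) ∂μ
  conj_inner_symm s t := by
    rw [← integral_conj]
    simp
  re_inner_nonneg s := by
    rw [← integral_re (integrable_inner s s)]
    exact integral_nonneg fun x => inner_self_nonneg
  add_left r s t := by
    rw [← integral_add (integrable_inner r t) (integrable_inner s t)]
    simp only [map_add, Pi.add_apply, inner_add_left]
  smul_left s t c := by
    rw [← integral_const_mul]
    simp only [map_smul, Pi.smul_apply, inner_smul_left]

instance : SeminormedAddCommGroup (PreL2 μ F E) :=
  InnerProductSpace.Core.toSeminormedAddCommGroup (c := core μ F E)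

instance : InnerProductSpace ℂ (PreL2 μ F E) := InnerProductSpace.ofCore (core μ F E)

variable {μ F E}

theorem inner_def (s t : PreL2 μ F E) :
    inner ℂ s t = ∫ x, inner ℂ (s.toFun x) (t.toFun x) ∂μ := rfl

theorem norm_sq_eq (s : PreL2 μ F E) : ‖s‖ ^ 2 = ∫ x, ‖s.toFun x‖ ^ 2 ∂μ := by
  rw [InnerProductSpace.norm_sq_eq_re_inner (𝕜 := ℂ), inner_def,
    ← integral_re (integrable_inner s s)]
  simp only [inner_self_eq_norm_sq]

theorem integrable_norm_sq (s : PreL2 μ F E) : Integrable (fun x => ‖s.toFun x‖ ^ 2) μ := by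
  simpa only [inner_self_eq_norm_sq] using (integrable_inner s s).re

/-- Multiplication of continuous sections by a continuous function. -/
def mul (φ : C(M, ℂ)) : PreL2 μ F E →L[ℂ] PreL2 μ F E :=
  LinearMap.mkContinuous
    { toFun := fun s => (⟨fun x => φ x • s.toFun x, by
        have h : Continuous fun x => (⟨x, φ x • s.toFun x + 0⟩ : TotalSpace F E) :=
          continuous_section_smul_add φ.continuous s.2 (continuous_zero_section F E)
        simp only [add_zero] at h
        exact h⟩ : continuousSections F E)
      map_add' := fun s t => Subtype.ext (funext fun x => by
        simp only [map_add, Pi.add_apply, smul_add]; rfl)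
      map_smul' := fun c s => Subtype.ext (funext fun x => by
        simp only [map_smul, Pi.smul_apply, smul_comm (φ x) c]; rfl) }
    ‖φ‖ (fun s => by
      refine (sq_le_sq₀ (norm_nonneg _) (by positivity)).1 ?_
      rw [mul_pow, norm_sq_eq, norm_sq_eq, ← integral_const_mul]
      refine integral_mono (integrable_norm_sq _) ((integrable_norm_sq s).const_mul _) fun x => ?_
      change ‖φ x • s.toFun x‖ ^ 2 ≤ _
      rw [norm_smul, mul_pow]
      gcongr
      exact φ.norm_coe_le_norm x)

theorem toFun_mul (φ : C(M, ℂ)) (s : PreL2 μ F E) (x : M) :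
    (mul φ s).toFun x = φ x • s.toFun x := rfl

/-- Translation of continuous sections by a group element: `(g s)(x) = g (s (g⁻¹ x))`. The map
`g : E (g⁻¹ x) → E x` is written as the inverse of `g⁻¹ : E x → E (g⁻¹ x)`. -/
def translate {G : Type*} [Group G] [TopologicalSpace G] [MulAction G M] [ContinuousConstSMul G M]
    [SMulInvariantMeasure G M μ] (σ : HermitianAction G F E) (g : G) :
    PreL2 μ F E →ₗᵢ[ℂ] PreL2 μ F E :=
  LinearMap.isometryOfInner
    { toFun := fun s => (⟨fun x => (σ.act g⁻¹ x).symm (s.toFun (g⁻¹ • x)), by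
        have hs : Continuous fun x => (⟨x, s.toFun x⟩ : TotalSpace F E) := s.2
        have h := σ.continuous_act.comp ((continuous_const (y := g)).prodMk
          (hs.comp (continuous_const_smul g⁻¹)))
        refine h.congr fun x => ?_
        have h1 := σ.mul_act g g⁻¹ x ((σ.act g⁻¹ x).symm (s.toFun (g⁻¹ • x)))
        rw [LinearIsometryEquiv.apply_symm_apply, mul_inv_cancel, σ.one_act] at h1
        exact h1.symm⟩ : continuousSections F E)
      map_add' := fun s t => Subtype.ext (funext fun x => by
        simp only [map_add, Pi.add_apply]; rfl)
      map_smul' := fun c s => Subtype.ext (funext fun x => by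
        simp only [map_smul, Pi.smul_apply]; rfl) }
    (fun s t => by
      rw [inner_def, inner_def, ← integral_smul_eq_self (μ := μ)
        (fun x => inner ℂ (s.toFun x) (t.toFun x)) (g := g⁻¹)]
      exact integral_congr_ae (Filter.Eventually.of_forall fun x =>
        (σ.act g⁻¹ x).symm.inner_map_map _ _))

end PreL2

variable [IsHermitianBundle F E]

/-- The Hilbert space `L²(M, E)` of square integrable sections of `E`, as the completion of the
space of continuous sections. -/
abbrev L2 : Type _ := UniformSpace.Completion (PreL2 μ F E)

variable {F E}

/-- The operator `M_φ` of multiplication by a continuous function `φ`. -/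
def mulOp (φ : C(M, ℂ)) : L2 μ F E →L[ℂ] L2 μ F E :=
  (PreL2.mul φ).completion

/-- The unitary action of `G` on `L²(M, E)`, extending `(g s)(x) = g (s (g⁻¹ x))`. -/
def translateOp {G : Type*} [Group G] [TopologicalSpace G] [MulAction G M]
    [ContinuousConstSMul G M] [SMulInvariantMeasure G M μ] (σ : HermitianAction G F E) (g : G) :
    L2 μ F E →L[ℂ] L2 μ F E :=
  (PreL2.translate σ g).toContinuousLinearMap.completion

/-- The closed subspace of `L²(M, E)` of sections supported in `S`. For clopen `S` this is
`L²(S, E|_S)`, extended by zero. -/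
def L2On (S : Set M) : Submodule ℂ (L2 μ F E) :=
  (Submodule.span ℂ {u : L2 μ F E | ∃ s : PreL2 μ F E, (∀ x ∉ S, s.toFun x = 0) ∧ u = s}
    ).topologicalClosure

/-! ### The algebras of operators that are local modulo compact operators -/

/-- `Ψ_M(ℋ)`: the bounded operators `P` on `ℋ = L²(M, E)` such that `M_φ P M_ψ` is compact for
all continuous functions `φ, ψ` on `M` with disjoint supports. -/
def PsiAlg : Set (L2 μ F E →L[ℂ] L2 μ F E) :=
  {P | ∀ φ ψ : C(M, ℂ), Disjoint (tsupport φ) (tsupport ψ) →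
    IsCompactOperator (mulOp μ φ ∘L P ∘L mulOp μ ψ)}

/-- `Ψ_S(ℋ)` for a clopen subset `S` of `M`: the operators that act on `L²(S, E)` only (they take
values in `L²(S, E)` and vanish on `L²(M ∖ S, E)`) and such that `M_φ P M_ψ` is compact
for all continuous functions `φ, ψ` on `S` (extended by zero) with disjoint supports. -/
def PsiAlgOn (S : Set M) : Set (L2 μ F E →L[ℂ] L2 μ F E) :=
  {P | (∀ u, P u ∈ L2On μ S) ∧ (∀ u ∈ L2On μ Sᶜ, P u = 0) ∧
    ∀ φ ψ : C(M, ℂ), tsupport φ ⊆ S → tsupport ψ ⊆ S → Disjoint (tsupport φ) (tsupport ψ) →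
      IsCompactOperator (mulOp μ φ ∘L P ∘L mulOp μ ψ)}

/-- `ℒ(ℋ)^G`: the bounded operators commuting with the action of `G`. -/
def invariantOps {G : Type*} [Group G] [TopologicalSpace G] [MulAction G M]
    [ContinuousConstSMul G M] [SMulInvariantMeasure G M μ] (σ : HermitianAction G F E) :
    Set (L2 μ F E →L[ℂ] L2 μ F E) :=
  {P | ∀ g, P ∘L translateOp μ σ g = translateOp μ σ g ∘L P}

end L2

/-! ### Isotypical components -/

/-- A (finite-dimensional, continuous) irreducible unitary representation of `G` on `V`. -/
structure UnitaryIrrep (G : Type*) [Group G] [TopologicalSpace G] (V : Type*)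
    [NormedAddCommGroup V] [InnerProductSpace ℂ V] where
  rep : G →* (V ≃ₗᵢ[ℂ] V)
  continuous_rep (v : V) : Continuous fun g => rep g v
  finiteDimensional : FiniteDimensional ℂ V
  nontrivial : Nontrivial V
  irreducible (W : Submodule ℂ V) (hW : ∀ g, ∀ w ∈ W, rep g w ∈ W) : W = ⊥ ∨ W = ⊤

section Isotypic

variable {G : Type*} [Group G] [TopologicalSpace G]
  {V : Type*} [NormedAddCommGroup V] [InnerProductSpace ℂ V]
  {H : Type*} [NormedAddCommGroup H] [InnerProductSpace ℂ H]

/-- The `α`-isotypical component of a subrepresentation `N` of a representation `U` of `G` on a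
Hilbert space: the closed sum of the images of all `G`-equivariant linear maps `α → N`, that is,
of all the submodules of `N` isomorphic to `α`. -/
def isotypic (α : UnitaryIrrep G V) (U : G → H →L[ℂ] H) (N : Submodule ℂ H) : Submodule ℂ H :=
  (⨆ f : {f : V →ₗ[ℂ] H // (∀ g v, f (α.rep g v) = U g (f v)) ∧ LinearMap.range f ≤ N},
    LinearMap.range f.1).topologicalClosure

instance [CompleteSpace H] (α : UnitaryIrrep G V) (U : G → H →L[ℂ] H) (N : Submodule ℂ H) :
    CompleteSpace (isotypic α U N) :=
  inferInstanceAs (CompleteSpace (Submodule.topologicalClosure _))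

/-- `π_α(T) = p_α T|_{N_α}`, as an operator on the `α`-isotypical component `N_α` of `N`, where
`p_α` is the orthogonal projection onto `N_α`. -/
def isotypicOp [CompleteSpace H] (α : UnitaryIrrep G V) (U : G → H →L[ℂ] H) (N : Submodule ℂ H)
    (T : H →L[ℂ] H) : isotypic α U N →L[ℂ] isotypic α U N :=
  (isotypic α U N).orthogonalProjectionOnto ∘L T ∘L (isotypic α U N).subtypeL

end Isotypic

/-! ### The transversal cotangent space -/

section Transversal

variable (d n : ℕ) (G : Type*) [Group G] [TopologicalSpace G]
  [ChartedSpace (EuclideanSpace ℝ (Fin d)) G]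
  {M : Type*} [TopologicalSpace M] [ChartedSpace (EuclideanSpace ℝ (Fin n)) M] [MulAction G M]

/-- The map `Y ↦ Y_M(x)` from the Lie algebra `T_1 G` of `G` to `T_x M` (here `(1 : G) • x = x`):
the derivative at `1` of the orbit map `g ↦ g • x`. -/
def infinitesimalAction (x : M) : TangentSpace (𝓡 d) (1 : G) →L[ℝ] TangentSpace (𝓡 n) x :=
  mfderiv (𝓡 d) (𝓡 n) (fun g : G => g • x) 1

/-- The fibre `(T*_G M)_x`: the covectors `ξ` at `x` with `ξ (Y_M(x)) = 0` for all `Y` in the Lie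
algebra of `G`. -/
def transversalCotangent (x : M) : Submodule ℝ (TangentSpace (𝓡 n) x →L[ℝ] ℝ) where
  carrier := {ξ | ∀ Y, ξ (infinitesimalAction d n G x Y) = 0}
  zero_mem' Y := rfl
  add_mem' {ξ η} hξ hη Y := by
    rw [add_apply, hξ Y, hη Y, add_zero]
  smul_mem' c ξ hξ Y := by
    rw [smul_apply, hξ Y, smul_zero]

/-- The set `𝒫` of the points `x` of `M` with `(T*_G M)_x = 0`. -/
def pathologicalSet (M : Type*) [TopologicalSpace M] [ChartedSpace (EuclideanSpace ℝ (Fin n)) M]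
    [MulAction G M] : Set M :=
  {x | transversalCotangent d n G x = ⊥}

end Transversal

/-- The characteristic function of a clopen set, as a continuous function. -/
def clopenChar {M : Type*} [TopologicalSpace M] {S : Set M} (hS : IsClopen S) : C(M, ℂ) :=
  (LocallyConstant.charFn ℂ hS).toContinuousMap

end

/-!
The covectors transversal to the orbit of `x` vanish exactly when the infinitesimal action is onto
`T_x M`. At such a point the orbit map is a submersion, so the orbit is open; it is also compact.
Thus every connected component of `M` that meets `𝒫` lies in a single orbit, which is contained in
`𝒫` by equivariance. As `M` is locally connected, `𝒫` is clopen (`isClopen_pathologicalSet`), it is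
`G`-invariant, and it is the union of finitely many orbits. The first part is then formal: the
functions `χ` and `1 - χ` are continuous with disjoint supports, so the off-diagonal terms of `P`
are compact.

For the second part the essential fact is that `L²(𝒫, E)_α` is finite-dimensional. Over an orbit
`G x`, a section `s` pulls back to the function `h ↦ h⁻¹ (s (h • x))` on `G` with values in the
finite-dimensional space `E x`. The invariant measure of the orbit is the image of a multiple of
the Haar measure (`exists_measurePreserving_orbit`), so this extends to an equivariant operator
`pullbackOp` from `L²(M, E)` to `L²(G, E x)`, isometric on the sections over the orbit. It is enough
that equivariant maps from `α` to `L²(G, W)` form a finite-dimensional space when `W` is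
finite-dimensional: by Fubini such a map is `v ↦ (h ↦ A (h⁻¹ v))` for a linear map `A : α → W`
(`exists_eq_matrixCoefficient`).

Hence the part of `ℋ_α` over `𝒫` is finite-dimensional, `π_α(P)` and `π_α(P₁)` differ by an operator
of finite rank, and leaving out a finite-dimensional summand on which `P₁` vanishes does not change
whether it is Fredholm.
-/

/-! ### Open orbits of a compact Lie group -/

/-- A map between boundaryless manifolds is open at every point where it is `C¹` with surjective
differential: the inverse function theorem, read in charts. -/
theorem range_mem_nhds_of_surjective_mfderiv {E H X E' H' Y : Type*}
    [NormedAddCommGroup E] [NormedSpace ℝ E] [CompleteSpace E] [TopologicalSpace H]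
    {I : ModelWithCorners ℝ E H} [I.Boundaryless] [TopologicalSpace X] [ChartedSpace H X]
    [NormedAddCommGroup E'] [NormedSpace ℝ E'] [CompleteSpace E'] [TopologicalSpace H']
    {I' : ModelWithCorners ℝ E' H'} [I'.Boundaryless] [TopologicalSpace Y] [ChartedSpace H' Y]
    {f : X → Y} {x : X} (hf : ContMDiffAt I I' 1 f x)
    (h : Function.Surjective (mfderiv I I' f x)) : Set.range f ∈ 𝓝 (f x) := by
  have hd : ContDiffAt ℝ 1 (writtenInExtChartAt I I' x f) (extChartAt I x x) := by
    have := (contMDiffAt_iff.1 hf).2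
    rwa [I.range_eq_univ, contDiffWithinAt_univ] at this
  have hs := hd.hasStrictFDerivAt one_ne_zero
  have heq : mfderiv I I' f x = fderiv ℝ (writtenInExtChartAt I I' x f) (extChartAt I x x) := by
    rw [(hf.mdifferentiableAt one_ne_zero).mfderiv, I.range_eq_univ, fderivWithin_univ]
  have hopen := hs.map_nhds_eq_of_surj (LinearMap.range_eq_top.2 (by rw [heq] at h; exact h))
  have hmem : ∀ᶠ y in 𝓝 (extChartAt I x x), f ((extChartAt I x).symm y) ∈
      (extChartAt I' (f x)).source := by
    have h1 : ContinuousAt (fun y => f ((extChartAt I x).symm y)) (extChartAt I x x) := by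
      refine ContinuousAt.comp ?_ (continuousAt_extChartAt_symm x)
      rw [extChartAt_to_inv]
      exact hf.continuousAt
    apply h1.preimage_mem_nhds
    rw [extChartAt_to_inv]
    exact extChartAt_source_mem_nhds (f x)
  have himg : writtenInExtChartAt I I' x f '' {y | f ((extChartAt I x).symm y) ∈
      (extChartAt I' (f x)).source} ∈ 𝓝 (extChartAt I' (f x) (f x)) := by
    have : writtenInExtChartAt I I' x f (extChartAt I x x) = extChartAt I' (f x) (f x) := by
      simp [writtenInExtChartAt]
    rw [← this, ← hopen]
    exact Filter.image_mem_map hmem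
  have hpre := (continuousAt_extChartAt (I := I') (f x)).preimage_mem_nhds himg
  filter_upwards [hpre, extChartAt_source_mem_nhds (I := I') (f x)] with z hz hz'
  obtain ⟨y, hy, hyz⟩ := hz
  exact ⟨_, (extChartAt I' (f x)).injOn hy hz' hyz⟩

section Orbits

variable {d n : ℕ} {G : Type*} [Group G] [TopologicalSpace G]
  [ChartedSpace (EuclideanSpace ℝ (Fin d)) G]
  {M : Type*} [TopologicalSpace M] [ChartedSpace (EuclideanSpace ℝ (Fin n)) M] [MulAction G M]

/-- There are no transversal covectors at `x` exactly when the action is infinitesimally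
transitive at `x`. -/
theorem mem_pathologicalSet_iff {x : M} :
    x ∈ pathologicalSet d n G M ↔ Function.Surjective (infinitesimalAction d n G x) := by
  constructor
  · intro hx
    by_contra hs
    obtain ⟨f, hf0, hf⟩ := Submodule.exists_le_ker_of_lt_top
      (LinearMap.range (infinitesimalAction d n G x).toLinearMap)
      (lt_top_iff_ne_top.2 fun h => hs (LinearMap.range_eq_top.1 h))
    have : FiniteDimensional ℝ (TangentSpace (𝓡 n) x) :=
      inferInstanceAs (FiniteDimensional ℝ (EuclideanSpace ℝ (Fin n)))
    have : T2Space (TangentSpace (𝓡 n) x) :=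
      inferInstanceAs (T2Space (EuclideanSpace ℝ (Fin n)))
    have hmem : LinearMap.toContinuousLinearMap f ∈ transversalCotangent d n G x :=
      fun Y => hf ⟨Y, rfl⟩
    rw [show transversalCotangent d n G x = ⊥ from hx, Submodule.mem_bot] at hmem
    exact hf0 (LinearMap.toContinuousLinearMap.map_eq_zero_iff.1 hmem)
  · intro hs
    refine (Submodule.eq_bot_iff _).2 fun ξ hξ => ContinuousLinearMap.ext fun v => ?_
    obtain ⟨Y, rfl⟩ := hs v
    exact hξ Y

variable [ContMDiffSMul (𝓡 d) (𝓡 n) ∞ G M]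

theorem contMDiff_orbitMap (x : M) : ContMDiff (𝓡 d) (𝓡 n) ∞ fun g : G => g • x :=
  contMDiff_id.smul contMDiff_const

/-- An infinitesimally transitive point is interior to its orbit, as the orbit map is a submersion
at `1`. -/
theorem orbit_mem_nhds_of_mem_pathologicalSet {x : M} (hx : x ∈ pathologicalSet d n G M) :
    MulAction.orbit G x ∈ 𝓝 x := by
  have h := range_mem_nhds_of_surjective_mfderiv (f := fun g : G => g • x) (x := 1)
    (((contMDiff_orbitMap (d := d) (n := n) x).contMDiffAt).of_le (by simp))
    (mem_pathologicalSet_iff.1 hx)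
  rwa [one_smul] at h

variable [LieGroup (𝓡 d) ∞ G]

/-- Infinitesimal transitivity is transported by the action: the orbit map of `g • x` precomposed
with conjugation by `g` is the orbit map of `x` followed by the diffeomorphism `g • ·`. -/
theorem smul_mem_pathologicalSet (g : G) {x : M} (hx : x ∈ pathologicalSet d n G M) :
    g • x ∈ pathologicalSet d n G M := by
  rw [mem_pathologicalSet_iff] at hx ⊢
  have hsm (g : G) : ContMDiff (𝓡 n) (𝓡 n) ∞ fun y : M => g • y :=
    ContMDiffSMul.contMDiff_const_smul (I := 𝓡 d) g
  have hconj : ContMDiff (𝓡 d) (𝓡 d) ∞ fun h : G => g * h * g⁻¹ :=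
    (contMDiff_const.mul contMDiff_id).mul contMDiff_const
  have h1 : g * 1 * g⁻¹ = 1 := by group
  have hfun : (fun h : G => h • g • x) ∘ (fun h : G => g * h * g⁻¹) =
      (fun y : M => g • y) ∘ fun h : G => h • x := by
    funext h
    simp [smul_smul]
  have hL : mfderiv (𝓡 d) (𝓡 n) ((fun h : G => h • g • x) ∘ (fun h : G => g * h * g⁻¹)) 1 =
      (mfderiv (𝓡 d) (𝓡 n) (fun h : G => h • g • x) (g * 1 * g⁻¹)).comp
        (mfderiv (𝓡 d) (𝓡 d) (fun h : G => g * h * g⁻¹) 1) :=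
    mfderiv_comp _ ((contMDiff_orbitMap _).mdifferentiable (by simp) _)
      (hconj.mdifferentiable (by simp) _)
  have hR : mfderiv (𝓡 d) (𝓡 n) ((fun y : M => g • y) ∘ fun h : G => h • x) 1 =
      (mfderiv (𝓡 n) (𝓡 n) (fun y : M => g • y) ((1 : G) • x)).comp
        (mfderiv (𝓡 d) (𝓡 n) (fun h : G => h • x) 1) :=
    mfderiv_comp _ ((hsm g).mdifferentiable (by simp) _)
      ((contMDiff_orbitMap _).mdifferentiable (by simp) _)
  have hsurj : Function.Surjective
      (mfderiv (𝓡 n) (𝓡 n) (fun y : M => g • y) ((1 : G) • x)) := by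
    have hid : (fun y : M => g • y) ∘ (fun y : M => g⁻¹ • y) = id := by
      funext y
      simp
    have hc : mfderiv (𝓡 n) (𝓡 n) ((fun y : M => g • y) ∘ (fun y : M => g⁻¹ • y)) (g • x) =
        (mfderiv (𝓡 n) (𝓡 n) (fun y : M => g • y) (g⁻¹ • g • x)).comp
          (mfderiv (𝓡 n) (𝓡 n) (fun y : M => g⁻¹ • y) (g • x)) :=
      mfderiv_comp _ ((hsm g).mdifferentiable (by simp) _)
        ((hsm g⁻¹).mdifferentiable (by simp) _)
    rw [hid, mfderiv_id] at hc
    rw [one_smul]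
    intro v
    have hv := DFunLike.congr_fun hc v
    rw [inv_smul_smul] at hv
    exact ⟨_, hv.symm⟩
  rw [hfun, hR] at hL
  intro v
  obtain ⟨w, hw⟩ := hsurj v
  obtain ⟨Y, hY⟩ := hx w
  have hv := DFunLike.congr_fun hL Y
  rw [h1] at hv
  refine ⟨_, hv.symm.trans ?_⟩
  exact (congrArg _ hY).trans hw

theorem smul_mem_pathologicalSet_iff (g : G) {x : M} :
    g • x ∈ pathologicalSet d n G M ↔ x ∈ pathologicalSet d n G M :=
  ⟨fun h => by simpa using smul_mem_pathologicalSet (d := d) (n := n) g⁻¹ h,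
    smul_mem_pathologicalSet g⟩

theorem orbit_subset_pathologicalSet {x : M} (hx : x ∈ pathologicalSet d n G M) :
    MulAction.orbit G x ⊆ pathologicalSet d n G M := by
  rintro _ ⟨g, rfl⟩
  exact smul_mem_pathologicalSet g hx

theorem isOpen_orbit_of_mem_pathologicalSet {x : M} (hx : x ∈ pathologicalSet d n G M) :
    IsOpen (MulAction.orbit G x) := by
  refine isOpen_iff_mem_nhds.2 fun y hy => ?_
  rw [← MulAction.orbit_eq_iff.2 hy]
  exact orbit_mem_nhds_of_mem_pathologicalSet (orbit_subset_pathologicalSet hx hy)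

variable [CompactSpace G] [T2Space M]

/-- Orbits in the pathological set are clopen, so each connected component of `M` which
meets the pathological set is contained in it. -/
theorem isClopen_pathologicalSet : IsClopen (pathologicalSet d n G M) := by
  have : LocallyConnectedSpace M :=
    ChartedSpace.locallyConnectedSpace (EuclideanSpace ℝ (Fin n)) M
  have hopen : IsOpen (pathologicalSet d n G M) := isOpen_iff_mem_nhds.2 fun x hx =>
    Filter.mem_of_superset (orbit_mem_nhds_of_mem_pathologicalSet hx)
      (orbit_subset_pathologicalSet hx)
  refine ⟨isClosed_of_closure_subset fun y hy => ?_, hopen⟩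
  obtain ⟨z, hz, hzP⟩ := mem_closure_iff.1 hy _ isOpen_connectedComponent mem_connectedComponent
  have hclopen : IsClopen (MulAction.orbit G z) :=
    ⟨(isCompact_range (contMDiff_orbitMap (d := d) (n := n) z).continuous).isClosed,
      isOpen_orbit_of_mem_pathologicalSet hzP⟩
  have hsub := hclopen.connectedComponent_subset (MulAction.mem_orbit_self z)
  exact orbit_subset_pathologicalSet hzP
    (hsub (connectedComponent_eq hz ▸ mem_connectedComponent))

/-- By compactness, the pathological set consists of finitely many orbits. -/
theorem exists_finset_orbits_cover [CompactSpace M] :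
    ∃ T : Finset M, pathologicalSet d n G M ⊆ ⋃ x ∈ T, MulAction.orbit G x := by
  obtain ⟨T, -, hcov⟩ := (isClopen_pathologicalSet (d := d) (n := n) (G := G)
    (M := M)).isClosed.isCompact.elim_nhds_subcover (fun x => MulAction.orbit G x)
    fun x hx => orbit_mem_nhds_of_mem_pathologicalSet hx
  exact ⟨T, hcov⟩

end Orbits

/-! ### Fredholm operators -/

section Fredholm

open LinearMap LinearMap.FiniteRangeSetoid

variable {X Y : Type*} [NormedAddCommGroup X] [NormedSpace ℂ X] [NormedAddCommGroup Y]
  [NormedSpace ℂ Y]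

theorem ContinuousLinearMap.isFredholm_of_finiteDimensional [FiniteDimensional ℂ X]
    (A : X →L[ℂ] X) : A.IsFredholm := by
  refine .of_isQuasiInverse (v := 0) ⟨?_, ?_⟩ <;>
  · refine equiv_iff_hasFiniteRange.2 ?_
    exact HasFiniteRange.of_finite_dom

theorem ContinuousLinearMap.IsFredholm.of_hasFiniteRange_sub {A B : X →L[ℂ] X}
    (h : (A.toLinearMap - B.toLinearMap).HasFiniteRange) (hB : B.IsFredholm) :
    A.IsFredholm := by
  obtain ⟨v, hv⟩ := hB.exists_isQuasiInverse
  exact .of_isQuasiInverse (v := v)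
    (hv.congr (Setoid.refl _) (equiv_iff_hasFiniteRange.2 h))

theorem ContinuousLinearMap.isFredholm_congr_of_hasFiniteRange_sub {A B : X →L[ℂ] X}
    (h : (A.toLinearMap - B.toLinearMap).HasFiniteRange) : A.IsFredholm ↔ B.IsFredholm := by
  refine ⟨.of_hasFiniteRange_sub ?_, .of_hasFiniteRange_sub h⟩
  rw [← neg_sub]
  exact h.neg

/-- If `X` is, up to a finite-dimensional complement, its retract `Y`, then an operator on `Y`
is Fredholm if and only if its extension to `X` is. -/
theorem ContinuousLinearMap.isFredholm_comp_iff {i : Y →L[ℂ] X} {p : X →L[ℂ] Y}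
    (hpi : ∀ y, p (i y) = y)
    (hip : (LinearMap.id - i.toLinearMap ∘ₗ p.toLinearMap).HasFiniteRange) (B : Y →L[ℂ] Y) :
    (i ∘L B ∘L p).IsFredholm ↔ B.IsFredholm := by
  have hq : p.toLinearMap.IsQuasiInverse i.toLinearMap := by
    constructor
    · have : p.toLinearMap ∘ₗ i.toLinearMap = LinearMap.id := LinearMap.ext hpi
      rw [IsLeftQuasiInverse, this]
    · exact Setoid.symm (equiv_iff_hasFiniteRange.2 hip)
  constructor
  · intro h
    obtain ⟨v, hv⟩ := h.exists_isQuasiInverse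
    have h1 : (p.toLinearMap ∘ₗ v.toLinearMap).IsQuasiInverse (i.toLinearMap ∘ₗ B.toLinearMap) :=
      IsQuasiInverse.of_comp_left (v := i.toLinearMap ∘ₗ B.toLinearMap) hq.symm hv
    have h2 := IsQuasiInverse.of_comp_right (u := B.toLinearMap) hq h1
    exact .of_isQuasiInverse (v := p ∘L v ∘L i) h2
  · intro h
    obtain ⟨v, hv⟩ := h.exists_isQuasiInverse
    have h1 := (hq.symm.comp hv).comp hq
    exact .of_isQuasiInverse (v := i ∘L v ∘L p) h1

end Fredholm

/-! ### Cutting off by a clopen set -/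

section ClopenChar

variable {M : Type*} [TopologicalSpace M]

theorem clopenChar_of_mem {S : Set M} (hS : IsClopen S) {x : M} (hx : x ∈ S) :
    clopenChar hS x = 1 := by
  simp [clopenChar, LocallyConstant.coe_charFn, hx]

theorem clopenChar_of_notMem {S : Set M} (hS : IsClopen S) {x : M} (hx : x ∉ S) :
    clopenChar hS x = 0 := by
  simp [clopenChar, LocallyConstant.coe_charFn, hx]

theorem one_sub_clopenChar_compl {S : Set M} (hS : IsClopen S) :
    1 - clopenChar hS.compl = clopenChar hS := by
  ext x
  by_cases hx : x ∈ S
  · have h : x ∉ Sᶜ := fun h => h hx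
    simp [clopenChar_of_mem hS hx, clopenChar_of_notMem hS.compl h]
  · simp [clopenChar_of_notMem hS hx, clopenChar_of_mem hS.compl hx]

theorem tsupport_clopenChar {S : Set M} (hS : IsClopen S) : tsupport (clopenChar hS) = S := by
  have : Function.support (clopenChar hS) = S := by
    ext x
    by_cases hx : x ∈ S
    · simp [clopenChar_of_mem hS hx, hx]
    · simp [clopenChar_of_notMem hS hx, hx]
  rw [tsupport, this, hS.isClosed.closure_eq]

theorem disjoint_tsupport_clopenChar {S : Set M} (hS : IsClopen S) :
    Disjoint (tsupport (clopenChar hS.compl)) (tsupport (clopenChar hS)) := by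
  rw [tsupport_clopenChar, tsupport_clopenChar]
  exact disjoint_compl_left

theorem clopenChar_smul {G : Type*} [Group G] [MulAction G M] {S : Set M}
    (hS : IsClopen S) (hG : ∀ (g : G) x, g • x ∈ S ↔ x ∈ S)
    (g : G) (x : M) : clopenChar hS (g • x) = clopenChar hS x := by
  by_cases hx : x ∈ S
  · rw [clopenChar_of_mem hS hx, clopenChar_of_mem hS ((hG g x).2 hx)]
  · rw [clopenChar_of_notMem hS hx, clopenChar_of_notMem hS (mt (hG g x).1 hx)]

end ClopenChar

theorem PreL2.toFun_injective {M : Type*} [TopologicalSpace M] [MeasurableSpace M]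
    {μ : Measure M} {F : Type*} [NormedAddCommGroup F] [NormedSpace ℂ F]
    {E : M → Type*} [∀ x, NormedAddCommGroup (E x)] [∀ x, InnerProductSpace ℂ (E x)]
    [TopologicalSpace (TotalSpace F E)] [FiberBundle F E] [VectorBundle ℂ F E] :
    Function.Injective (PreL2.toFun (μ := μ) (F := F) (E := E)) :=
  Subtype.val_injective

section Cutoff

variable {M : Type*} [TopologicalSpace M] [CompactSpace M] [MeasurableSpace M] [BorelSpace M]
  {μ : Measure M} [IsFiniteMeasure μ]
  {F : Type*} [NormedAddCommGroup F] [NormedSpace ℂ F]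
  {E : M → Type*} [∀ x, NormedAddCommGroup (E x)] [∀ x, InnerProductSpace ℂ (E x)]
  [TopologicalSpace (TotalSpace F E)] [FiberBundle F E] [VectorBundle ℂ F E]
  [IsHermitianBundle F E]

theorem mulOp_coe (φ : C(M, ℂ)) (s : PreL2 μ F E) :
    mulOp μ φ (s : L2 μ F E) = (PreL2.mul φ s : PreL2 μ F E) :=
  ContinuousLinearMap.completion_apply_coe _ _

/-- Two bounded operators on `L²(M, E)` that agree on continuous sections are equal. -/
theorem L2.clm_ext {Y : Type*} [NormedAddCommGroup Y] [NormedSpace ℂ Y]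
    {A B : L2 μ F E →L[ℂ] Y} (h : ∀ s : PreL2 μ F E, A s = B s) : A = B := by
  ext u
  induction u using UniformSpace.Completion.induction_on with
  | hp => exact isClosed_eq A.continuous B.continuous
  | ih s => exact h s

theorem mulOp_mul (φ ψ : C(M, ℂ)) :
    mulOp (F := F) (E := E) μ (φ * ψ) = mulOp μ φ ∘L mulOp μ ψ :=
  L2.clm_ext fun s => by
    rw [ContinuousLinearMap.comp_apply, mulOp_coe, mulOp_coe, mulOp_coe]
    congr 1
    apply PreL2.toFun_injective
    funext x
    simp only [PreL2.toFun_mul, ContinuousMap.mul_apply, mul_smul]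

theorem mulOp_add (φ ψ : C(M, ℂ)) :
    mulOp (F := F) (E := E) μ (φ + ψ) = mulOp μ φ + mulOp μ ψ :=
  L2.clm_ext fun s => by
    rw [add_apply, mulOp_coe, mulOp_coe, mulOp_coe, ← UniformSpace.Completion.coe_add]
    congr 1
    apply PreL2.toFun_injective
    funext x
    simp only [PreL2.toFun_mul, map_add, Pi.add_apply, ContinuousMap.add_apply, add_smul]

theorem mulOp_one : mulOp (F := F) (E := E) μ 1 = ContinuousLinearMap.id ℂ _ :=
  L2.clm_ext fun s => by
    rw [mulOp_coe, ContinuousLinearMap.id_apply]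
    congr 1
    apply PreL2.toFun_injective
    funext x
    simp only [PreL2.toFun_mul, ContinuousMap.one_apply, one_smul]

theorem mulOp_clopenChar_add {S : Set M} (hS : IsClopen S) :
    mulOp (F := F) (E := E) μ (clopenChar hS.compl) + mulOp μ (clopenChar hS) =
      ContinuousLinearMap.id ℂ _ := by
  rw [← mulOp_add, ← one_sub_clopenChar_compl hS, add_sub_cancel, mulOp_one]

theorem isClosed_L2On (S : Set M) : IsClosed (L2On (F := F) (E := E) μ S : Set (L2 μ F E)) :=
  Submodule.isClosed_topologicalClosure _

theorem coe_mem_L2On {S : Set M} {s : PreL2 μ F E} (hs : ∀ x ∉ S, s.toFun x = 0) :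
    (s : L2 μ F E) ∈ L2On μ S :=
  Submodule.le_topologicalClosure _ (Submodule.subset_span ⟨s, hs, rfl⟩)

/-- Bounded operators that agree on the continuous sections supported in `S` agree on `L²(S, E)`. -/
theorem L2On.eqOn {Y : Type*} [NormedAddCommGroup Y] [NormedSpace ℂ Y] {S : Set M}
    {A B : L2 μ F E →L[ℂ] Y}
    (h : ∀ s : PreL2 μ F E, (∀ x ∉ S, s.toFun x = 0) → A s = B s) {u : L2 μ F E}
    (hu : u ∈ L2On μ S) : A u = B u := by
  have hle : L2On (F := F) (E := E) μ S ≤ LinearMap.eqLocus A.toLinearMap B.toLinearMap := by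
    refine Submodule.topologicalClosure_minimal _ (Submodule.span_le.2 ?_)
      (isClosed_eq A.continuous B.continuous)
    rintro _ ⟨s, hs, rfl⟩
    exact h s hs
  exact hle hu

theorem mulOp_clopenChar_mem {S : Set M} (hS : IsClopen S) (u : L2 μ F E) :
    mulOp μ (clopenChar hS) u ∈ L2On μ S := by
  induction u using UniformSpace.Completion.induction_on with
  | hp => exact (isClosed_L2On S).preimage (mulOp μ (clopenChar hS)).continuous
  | ih s =>
    rw [mulOp_coe]
    refine coe_mem_L2On fun x hx => ?_
    rw [PreL2.toFun_mul, clopenChar_of_notMem hS hx, zero_smul]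

theorem mulOp_clopenChar_of_mem {S : Set M} (hS : IsClopen S) {u : L2 μ F E}
    (hu : u ∈ L2On μ S) : mulOp μ (clopenChar hS) u = u := by
  refine L2On.eqOn (B := ContinuousLinearMap.id ℂ _) (fun s hs => ?_) hu
  rw [mulOp_coe, ContinuousLinearMap.id_apply]
  congr 1
  apply PreL2.toFun_injective
  funext x
  rw [PreL2.toFun_mul]
  by_cases hx : x ∈ S
  · rw [clopenChar_of_mem hS hx, one_smul]
  · rw [hs x hx, smul_zero]

theorem mulOp_clopenChar_of_mem_compl {S : Set M} (hS : IsClopen S) {u : L2 μ F E}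
    (hu : u ∈ L2On μ Sᶜ) : mulOp μ (clopenChar hS) u = 0 := by
  have h := DFunLike.congr_fun (mulOp_clopenChar_add (F := F) (E := E) (μ := μ) hS) u
  rw [add_apply, mulOp_clopenChar_of_mem hS.compl hu] at h
  simpa using h

/-- Cutting off on both sides by a clopen set keeps an operator local modulo compact operators. -/
theorem cutoff_mem_PsiAlgOn {S : Set M} (hS : IsClopen S) {P : L2 μ F E →L[ℂ] L2 μ F E}
    (hP : P ∈ PsiAlg μ) :
    mulOp μ (clopenChar hS) ∘L P ∘L mulOp μ (clopenChar hS) ∈ PsiAlgOn μ S := by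
  refine ⟨fun u => ?_, fun u hu => ?_, fun φ ψ _ _ h => ?_⟩
  · rw [ContinuousLinearMap.comp_apply]
    exact mulOp_clopenChar_mem hS _
  · rw [ContinuousLinearMap.comp_apply, ContinuousLinearMap.comp_apply,
      mulOp_clopenChar_of_mem_compl hS hu, map_zero, map_zero]
  · have h1 : tsupport (φ * clopenChar hS) ⊆ tsupport φ :=
      closure_mono fun x hx hφ => hx (by simp [hφ])
    have h2 : tsupport (clopenChar hS * ψ) ⊆ tsupport ψ :=
      closure_mono fun x hx hψ => hx (by simp [hψ])
    have h3 := hP _ _ (h.mono h1 h2)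
    rw [mulOp_mul, mulOp_mul] at h3
    rw [ContinuousLinearMap.comp_assoc, ContinuousLinearMap.comp_assoc]
    rw [ContinuousLinearMap.comp_assoc] at h3
    exact h3

variable {G : Type*} [Group G] [TopologicalSpace G] [MulAction G M] [ContinuousConstSMul G M]
  [SMulInvariantMeasure G M μ] (σ : HermitianAction G F E)

theorem translateOp_coe (g : G) (s : PreL2 μ F E) :
    translateOp μ σ g (s : L2 μ F E) = (PreL2.translate σ g s : PreL2 μ F E) :=
  ContinuousLinearMap.completion_apply_coe _ _

theorem PreL2.toFun_translate (g : G) (s : PreL2 μ F E) (x : M) :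
    (PreL2.translate σ g s).toFun x = (σ.act g⁻¹ x).symm (s.toFun (g⁻¹ • x)) := rfl

theorem mulOp_comp_translateOp {φ : C(M, ℂ)} (hφ : ∀ (g : G) x, φ (g • x) = φ x) (g : G) :
    mulOp μ φ ∘L translateOp μ σ g = translateOp μ σ g ∘L mulOp μ φ :=
  L2.clm_ext fun s => by
    rw [ContinuousLinearMap.comp_apply, ContinuousLinearMap.comp_apply, mulOp_coe,
      translateOp_coe, translateOp_coe, mulOp_coe]
    congr 1
    apply PreL2.toFun_injective
    funext x
    simp only [PreL2.toFun_mul, PreL2.toFun_translate, hφ, map_smul]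

theorem comp_mem_invariantOps {A B : L2 μ F E →L[ℂ] L2 μ F E} (hA : A ∈ invariantOps μ σ)
    (hB : B ∈ invariantOps μ σ) : A ∘L B ∈ invariantOps μ σ := fun g => by
  rw [ContinuousLinearMap.comp_assoc, hB g, ← ContinuousLinearMap.comp_assoc, hA g,
    ContinuousLinearMap.comp_assoc]

end Cutoff

/-! ### Multiplicities in the regular representation -/

section Frobenius

variable {G : Type*} [Group G] [TopologicalSpace G] [IsTopologicalGroup G]
  [SecondCountableTopology G] [MeasurableSpace G] [BorelSpace G]
  {V : Type*} [NormedAddCommGroup V] [InnerProductSpace ℂ V]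
  {W : Type*} [NormedAddCommGroup W] [InnerProductSpace ℂ W]

/-- The equivariant linear maps from `α` to `L²(G, W)` with its left regular representation. -/
noncomputable def regularHom (α : UnitaryIrrep G V) (W : Type*) [NormedAddCommGroup W]
    [InnerProductSpace ℂ W]
    (ν : Measure G) [ν.IsMulLeftInvariant] : Submodule ℂ (V →ₗ[ℂ] Lp W 2 ν) where
  carrier := {f | ∀ g v, f (α.rep g v) =
    Lp.compMeasurePreserving (g⁻¹ * ·) (measurePreserving_mul_left ν g⁻¹) (f v)}
  zero_mem' g v := by simp
  add_mem' hf hf' g v := by simp [hf g v, hf' g v]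
  smul_mem' c f hf g v := by
    simp only [LinearMap.smul_apply, hf g v]
    exact ((Lp.compMeasurePreservingₗ ℂ _ (measurePreserving_mul_left ν g⁻¹)).map_smul c _).symm

/-- Frobenius reciprocity: an equivariant map from `α` to `L²(G, W)` is `v ↦ (h ↦ A (h⁻¹ v))` for
a linear map `A : α → W`. Equivariance gives `f (g v) h = f v (g⁻¹ h)` for every `g` and almost
every `h`; by Fubini there is one `h₀` for which it holds for almost every `g`, and then
`A = f (·) h₀ ∘ h₀`. -/
theorem exists_eq_matrixCoefficient (α : UnitaryIrrep G V) {ν : Measure G} [SFinite ν]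
    [ν.IsMulLeftInvariant] {f : V →ₗ[ℂ] Lp W 2 ν} (hf : f ∈ regularHom α W ν) :
    ∃ A : V →ₗ[ℂ] W, ∀ v, f v =ᵐ[ν] fun h => A (α.rep h⁻¹ v) := by
  by_cases hν : ν = 0
  · subst hν
    exact ⟨0, fun v => by simp [Filter.EventuallyEq]⟩
  have : NeZero ν := ⟨hν⟩
  have := α.finiteDimensional
  let b := Module.finBasis ℂ V
  let Φ (i) : G → W := f (b i)
  -- an everywhere defined representative of `f`, linear in the vector of `V`
  let Ψ (h : G) : V →ₗ[ℂ] W := b.constr ℂ fun i => Φ i h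
  have hΨ (h : G) (v : V) : Ψ h v = ∑ i, b.repr v i • Φ i h := b.constr_apply_fintype ℂ _ v
  have hrep (v : V) : f v =ᵐ[ν] fun h => Ψ h v := by
    have h1 : f v = ∑ i, b.repr v i • f (b i) := by
      conv_lhs => rw [← b.sum_repr v, map_sum]
      simp only [map_smul]
    have h2 := Lp.coeFn_fun_finsetSum Finset.univ (fun i => b.repr v i • f (b i))
    have h3 : ∀ᵐ h ∂ν, ∀ i, (b.repr v i • f (b i) : Lp W 2 ν) h = b.repr v i • Φ i h :=
      ae_all_iff.2 fun i => Lp.coeFn_smul _ _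
    rw [h1]
    filter_upwards [h2, h3] with h h2 h3
    rw [h2, hΨ]
    exact Finset.sum_congr rfl fun i _ => h3 i
  have hequi (g : G) : ∀ᵐ h ∂ν, ∀ i, Ψ h (α.rep g (b i)) = Ψ (g⁻¹ * h) (b i) := by
    rw [ae_all_iff]
    intro i
    have h1 := hrep (α.rep g (b i))
    have h2 := (measurePreserving_mul_left ν g⁻¹).quasiMeasurePreserving.ae (hrep (b i))
    have h3 := Lp.coeFn_compMeasurePreserving (f (b i)) (measurePreserving_mul_left ν g⁻¹)
    rw [hf g (b i)] at h1
    filter_upwards [h1, h2, h3] with h h1 h2 h3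
    rw [← h1, h3, Function.comp_apply, h2]
  have hmeas : MeasurableSet
      {p : G × G | ∀ i, Ψ p.2 (α.rep p.1 (b i)) = Ψ (p.1⁻¹ * p.2) (b i)} := by
    have hΦ (i) : StronglyMeasurable (Φ i) := Lp.stronglyMeasurable _
    have hΨ1 (v : V) : StronglyMeasurable fun h => Ψ h v := by
      simp only [hΨ]
      exact Finset.stronglyMeasurable_fun_sum _ fun i _ => (hΦ i).const_smul _
    simp only [Set.ofPred_forall]
    refine MeasurableSet.iInter fun i => ?_
    refine StronglyMeasurable.measurableSet_eq_fun ?_ ?_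
    · simp only [hΨ]
      refine Finset.stronglyMeasurable_fun_sum _ fun j _ => StronglyMeasurable.smul ?_
        ((hΦ j).comp_measurable measurable_snd)
      have hc : Continuous fun v => b.repr v j :=
        LinearMap.continuous_of_finiteDimensional (b.coord j)
      exact ((hc.comp (α.continuous_rep (b i))).comp continuous_fst).stronglyMeasurable
    · exact (hΨ1 (b i)).comp_measurable (measurable_fst.inv.mul measurable_snd)
  have hswap : ∀ᵐ h ∂ν, ∀ᵐ g ∂ν, ∀ i, Ψ h (α.rep g (b i)) = Ψ (g⁻¹ * h) (b i) :=
    (Measure.ae_ae_comm hmeas).1 (Filter.Eventually.of_forall hequi)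
  obtain ⟨h₀, hh₀⟩ := hswap.exists
  refine ⟨Ψ h₀ ∘ₗ (α.rep h₀).toLinearMap, fun v => ?_⟩
  -- substitute `g = h₀ u⁻¹`
  have hsub : ∀ᵐ u ∂ν, ∀ i, Ψ h₀ (α.rep (h₀ * u⁻¹) (b i)) = Ψ u (b i) := by
    filter_upwards [(quasiMeasurePreserving_div_left ν h₀).ae hh₀] with u hu i
    simpa [div_eq_mul_inv] using hu i
  filter_upwards [hrep v, hsub] with u hu hsub
  have : Ψ h₀ ∘ₗ (α.rep (h₀ * u⁻¹)).toLinearMap = Ψ u := b.ext hsub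
  rw [hu, ← this, map_mul]
  rfl

/-- The multiplicity of `α` in `L²(G, W)` is finite: it is at most `dim Hom(α, W)`. -/
theorem finiteDimensional_regularHom (α : UnitaryIrrep G V) [FiniteDimensional ℂ W]
    (ν : Measure G) [SFinite ν] [ν.IsMulLeftInvariant] :
    FiniteDimensional ℂ (regularHom α W ν) := by
  have := α.finiteDimensional
  -- the graph of the correspondence between `A` and `f` projects injectively to the `A`'s
  let R : Submodule ℂ ((V →ₗ[ℂ] W) × (V →ₗ[ℂ] Lp W 2 ν)) :=
    { carrier := {p | ∀ v, p.2 v =ᵐ[ν] fun h => p.1 (α.rep h⁻¹ v)}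
      zero_mem' := fun v => Lp.coeFn_zero W 2 ν
      add_mem' := fun {p q} hp hq v => by
        filter_upwards [hp v, hq v, Lp.coeFn_add (p.2 v) (q.2 v)] with h h1 h2 h3
        simp only [Prod.snd_add, LinearMap.add_apply, Prod.fst_add, h3, Pi.add_apply, h1, h2]
      smul_mem' := fun c p hp v => by
        filter_upwards [hp v, Lp.coeFn_smul c (p.2 v)] with h h1 h2
        simp only [Prod.smul_snd, LinearMap.smul_apply, Prod.smul_fst, h2, Pi.smul_apply, h1] }
  have hR : FiniteDimensional ℂ R := by
    refine FiniteDimensional.of_injective (LinearMap.fst ℂ _ _ ∘ₗ R.subtype) fun p q hpq => ?_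
    have h1 : p.1.1 = q.1.1 := hpq
    refine Subtype.ext (Prod.ext h1 (LinearMap.ext fun v => Lp.ext ?_))
    refine (p.2 v).trans (Filter.EventuallyEq.trans ?_ (q.2 v).symm)
    rw [h1]
  have hle : regularHom α W ν ≤ R.map (LinearMap.snd ℂ _ _) := fun f hf => by
    obtain ⟨A, hA⟩ := exists_eq_matrixCoefficient α hf
    exact ⟨(A, f), hA, rfl⟩
  exact Submodule.finiteDimensional_of_le hle

end Frobenius

/-! ### Pulling sections back to the group -/

section OrbitMeasure

variable {G : Type*} [Group G] [TopologicalSpace G] [IsTopologicalGroup G] [CompactSpace G]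
  [MeasurableSpace G] [BorelSpace G]

/-- A Haar probability measure on a compact group is right invariant, as a right translate of it
is another Haar probability measure. -/
theorem isMulRightInvariant_of_compactSpace (η : Measure G) [η.IsHaarMeasure]
    [IsProbabilityMeasure η] : η.IsMulRightInvariant where
  map_mul_right_eq_self g := by
    have : IsProbabilityMeasure (η.map (· * g)) :=
      Measure.isProbabilityMeasure_map (measurable_mul_const g).aemeasurable
    exact Measure.isHaarMeasure_eq_of_isProbabilityMeasure _ _

/-- The restriction of an invariant finite measure to an orbit is the image of a multiple of the
Haar measure: average over the group, apply Fubini, and use that the mass of `{h | h • y ∈ A}`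
does not depend on the point `y` of the orbit. -/
theorem exists_measurePreserving_orbit [SecondCountableTopology G] {M : Type*}
    [TopologicalSpace M] [T2Space M] [SecondCountableTopology M] [MeasurableSpace M]
    [BorelSpace M] [MulAction G M] [ContinuousSMul G M] (μ : Measure M) [IsFiniteMeasure μ]
    [SMulInvariantMeasure G M μ] (x : M) :
    ∃ ν : Measure G, IsFiniteMeasure ν ∧ ν.IsMulLeftInvariant ∧
      MeasurePreserving (fun h : G => h • x) ν (μ.restrict (MulAction.orbit G x)) := by
  let η : Measure G := Measure.haarMeasure ⊤
  have hη : IsProbabilityMeasure η := ⟨Measure.haarMeasure_self⟩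
  have := isMulRightInvariant_of_compactSpace η
  let O := MulAction.orbit G x
  have hsmul : Continuous fun h : G => h • x := continuous_id.smul continuous_const
  have hO : MeasurableSet O := (isCompact_range hsmul).isClosed.measurableSet
  -- the total mass has to be that of the orbit; it may vanish
  refine ⟨(μ O).toNNReal • η, inferInstance, inferInstance, hsmul.measurable, ?_⟩
  ext A hA
  have hpre : MeasurableSet ((fun p : G × M => p.1 • p.2) ⁻¹' A) :=
    continuous_smul.measurable hA
  have h1 := Measure.prod_apply (μ := η) (ν := μ.restrict O) hpre
  have h2 := Measure.prod_apply_symm (μ := η) (ν := μ.restrict O) hpre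
  have hleft (g : G) : μ.restrict O (Prod.mk g ⁻¹' ((fun p : G × M => p.1 • p.2) ⁻¹' A)) =
      μ.restrict O A := by
    have hm : MeasurableSet ((fun y => g • y) ⁻¹' A) := (continuous_const_smul g).measurable hA
    have hinv : (fun y => g • y) ⁻¹' A ∩ O = (fun y => g • y) ⁻¹' (A ∩ O) := by
      ext y
      simp [O, ← MulAction.orbit_eq_iff]
    change μ.restrict O ((fun y => g • y) ⁻¹' A) = _
    rw [Measure.restrict_apply hm, Measure.restrict_apply hA, hinv,
      measure_preimage_smul]
  have hright : ∀ y ∈ O, η ((fun g : G => (g, y)) ⁻¹' ((fun p : G × M => p.1 • p.2) ⁻¹' A)) =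
      η ((fun h : G => h • x) ⁻¹' A) := by
    rintro _ ⟨k, rfl⟩
    rw [← measure_preimage_mul_right η k ((fun h : G => h • x) ⁻¹' A)]
    congr 1
    ext g
    simp [mul_smul]
  simp only [hleft, lintegral_const, measure_univ, mul_one] at h1
  rw [setLIntegral_congr_fun hO hright, setLIntegral_const] at h2
  rw [Measure.map_apply hsmul.measurable hA, ← h1, h2, Measure.smul_apply, mul_comm]
  simp [ENNReal.smul_def, measure_ne_top, O]

end OrbitMeasure

section Pullback

theorem norm_sq_toLp {X : Type*} [TopologicalSpace X] [CompactSpace X]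
    [SecondCountableTopology X] [MeasurableSpace X] [BorelSpace X] (ν : Measure X)
    [IsFiniteMeasure ν] {W : Type*} [NormedAddCommGroup W] [InnerProductSpace ℂ W] (f : C(X, W)) :
    ‖ContinuousMap.toLp 2 ν ℂ f‖ ^ 2 = ∫ h, ‖f h‖ ^ 2 ∂ν := by
  rw [InnerProductSpace.norm_sq_eq_re_inner (𝕜 := ℂ), L2.inner_def,
    ← integral_re (L2.integrable_inner _ _)]
  refine integral_congr_ae ?_
  filter_upwards [ContinuousMap.coeFn_toLp (p := 2) (𝕜 := ℂ) ν f] with h hh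
  rw [hh, inner_self_eq_norm_sq]

variable {M : Type*} [TopologicalSpace M] [CompactSpace M] [MeasurableSpace M] [BorelSpace M]
  {μ : Measure M} [IsFiniteMeasure μ]
  {F : Type*} [NormedAddCommGroup F] [NormedSpace ℂ F]
  {E : M → Type*} [∀ x, NormedAddCommGroup (E x)] [∀ x, InnerProductSpace ℂ (E x)]
  [TopologicalSpace (TotalSpace F E)] [FiberBundle F E] [VectorBundle ℂ F E]
  [IsHermitianBundle F E]
  {G : Type*} [Group G] [TopologicalSpace G] [IsTopologicalGroup G]
  [MulAction G M] [ContinuousSMul G M]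
  (σ : HermitianAction G F E)

/-- The pull-back of a continuous section along the orbit map `h ↦ h • x`, moved to the fibre
`E x` by the action: `h ↦ h⁻¹ (s (h • x))`. -/
noncomputable def pullbackFun (x : M) (s : PreL2 μ F E) : C(G, E x) where
  toFun h := (σ.act h x).symm (s.toFun (h • x))
  continuous_toFun := by
    rw [(FiberBundle.totalSpaceMk_isInducing F E x).continuous_iff]
    have hs : Continuous fun x => (⟨x, s.toFun x⟩ : TotalSpace F E) := s.2
    have h := σ.continuous_act.comp ((continuous_inv (G := G)).prodMk
      (hs.comp (continuous_id.smul continuous_const : Continuous fun h : G => h • x)))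
    refine h.congr fun g => ?_
    -- `g⁻¹ (s (g • x))` lies in the fibre over `g⁻¹ • g • x`, which is `x` only propositionally
    have h1 := σ.mul_act g⁻¹ g x ((σ.act g x).symm (s.toFun (g • x)))
    rw [LinearIsometryEquiv.apply_symm_apply, inv_mul_cancel, σ.one_act] at h1
    exact h1.symm

theorem pullbackFun_translate [SMulInvariantMeasure G M μ] (x : M) (g : G) (s : PreL2 μ F E)
    (h : G) : pullbackFun σ x (PreL2.translate σ g s) h = pullbackFun σ x s (g⁻¹ * h) := by
  change (σ.act h x).symm ((σ.act g⁻¹ (h • x)).symm (s.toFun (g⁻¹ • h • x))) =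
    (σ.act (g⁻¹ * h) x).symm (s.toFun ((g⁻¹ * h) • x))
  rw [LinearIsometryEquiv.eq_symm_apply]
  have h1 := σ.mul_act g⁻¹ h x
    ((σ.act h x).symm ((σ.act g⁻¹ (h • x)).symm (s.toFun (g⁻¹ • h • x))))
  rw [LinearIsometryEquiv.apply_symm_apply, LinearIsometryEquiv.apply_symm_apply] at h1
  have h2 : (⟨g⁻¹ • h • x, s.toFun (g⁻¹ • h • x)⟩ : TotalSpace F E) =
      ⟨(g⁻¹ * h) • x, s.toFun ((g⁻¹ * h) • x)⟩ := by rw [mul_smul]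
  exact TotalSpace.mk_injective _ (h1.trans h2)

variable [CompactSpace G] [SecondCountableTopology G] [MeasurableSpace G] [BorelSpace G]
  {ν : Measure G} [IsFiniteMeasure ν]

theorem norm_sq_toLp_pullbackFun {x : M}
    (hν : MeasurePreserving (fun h : G => h • x) ν (μ.restrict (MulAction.orbit G x)))
    (s : PreL2 μ F E) :
    ‖ContinuousMap.toLp 2 ν ℂ (pullbackFun σ x s)‖ ^ 2 =
      ∫ y in MulAction.orbit G x, ‖s.toFun y‖ ^ 2 ∂μ := by
  have hs := (PreL2.integrable_norm_sq s).aestronglyMeasurable.restrict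
    (s := MulAction.orbit G x)
  rw [norm_sq_toLp]
  have hnorm (h : G) : ‖pullbackFun σ x s h‖ = ‖s.toFun (h • x)‖ := (σ.act h x).symm.norm_map _
  simp only [hnorm]
  rw [← hν.map_eq] at hs ⊢
  exact (integral_map hν.measurable.aemeasurable hs).symm

/-- The operator `L²(M, E) → L²(G, E x)` that extends the pull-back of continuous sections. -/
noncomputable def pullbackOp {x : M} [CompleteSpace (E x)]
    (hν : MeasurePreserving (fun h : G => h • x) ν (μ.restrict (MulAction.orbit G x))) :
    L2 μ F E →L[ℂ] Lp (E x) 2 ν :=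
  (LinearMap.mkContinuous
    { toFun := fun s : PreL2 μ F E => ContinuousMap.toLp 2 ν ℂ (pullbackFun σ x s)
      map_add' := fun s t => by
        rw [← map_add]
        congr 1
        ext h
        simp [pullbackFun]
      map_smul' := fun c s => by
        rw [RingHom.id_apply, ← map_smul]
        congr 1
        ext h
        simp [pullbackFun] } 1 (fun s => by
      refine (sq_le_sq₀ (norm_nonneg _) (by positivity)).1 ?_
      rw [one_mul, PreL2.norm_sq_eq, LinearMap.coe_mk, AddHom.coe_mk,
        norm_sq_toLp_pullbackFun σ hν]
      exact setIntegral_le_integral (PreL2.integrable_norm_sq s)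
        (Filter.Eventually.of_forall fun y => by positivity))).extend
    (UniformSpace.Completion.toComplL (𝕜 := ℂ) (E := PreL2 μ F E))

variable {x : M} [CompleteSpace (E x)]
  (hν : MeasurePreserving (fun h : G => h • x) ν (μ.restrict (MulAction.orbit G x)))

theorem pullbackOp_coe (s : PreL2 μ F E) :
    pullbackOp σ hν (s : L2 μ F E) = ContinuousMap.toLp 2 ν ℂ (pullbackFun σ x s) :=
  ContinuousLinearMap.extend_eq _ UniformSpace.Completion.denseRange_coe
    (UniformSpace.Completion.isUniformInducing_coe _) s

theorem pullbackOp_translateOp [SMulInvariantMeasure G M μ] [ν.IsMulLeftInvariant] (g : G)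
    (u : L2 μ F E) : pullbackOp σ hν (translateOp μ σ g u) =
      Lp.compMeasurePreserving (g⁻¹ * ·) (measurePreserving_mul_left ν g⁻¹)
        (pullbackOp σ hν u) := by
  induction u using UniformSpace.Completion.induction_on with
  | hp =>
    exact isClosed_eq ((pullbackOp σ hν).continuous.comp (translateOp μ σ g).continuous)
      ((Lp.isometry_compMeasurePreserving _).continuous.comp (pullbackOp σ hν).continuous)
  | ih s =>
    rw [translateOp_coe, pullbackOp_coe, pullbackOp_coe]
    refine Lp.ext ?_
    have hL := measurePreserving_mul_left ν g⁻¹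
    have h1 := ContinuousMap.coeFn_toLp (p := 2) (𝕜 := ℂ) ν
      (pullbackFun σ x (PreL2.translate σ g s))
    have h2 := hL.quasiMeasurePreserving.ae
      (ContinuousMap.coeFn_toLp (p := 2) (𝕜 := ℂ) ν (pullbackFun σ x s))
    have h3 := Lp.coeFn_compMeasurePreserving
      (ContinuousMap.toLp 2 ν ℂ (pullbackFun σ x s)) hL
    filter_upwards [h1, h2, h3] with h h1 h2 h3
    rw [h1, h3, Function.comp_apply, h2, pullbackFun_translate]

end Pullback

/-! ### Isotypical components -/

section Isotypic

variable {G : Type*} [Group G] [TopologicalSpace G]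
  {V : Type*} [NormedAddCommGroup V] [InnerProductSpace ℂ V]
  {H : Type*} [NormedAddCommGroup H] [InnerProductSpace ℂ H]
  (α : UnitaryIrrep G V) (U : G → H →L[ℂ] H)

/-- The `G`-equivariant linear maps from `α` to a subspace `N` of a representation. -/
noncomputable def equivariantHom (N : Submodule ℂ H) : Submodule ℂ (V →ₗ[ℂ] H) where
  carrier := {f | (∀ g v, f (α.rep g v) = U g (f v)) ∧ LinearMap.range f ≤ N}
  zero_mem' := ⟨by simp, by simp⟩
  add_mem' {f f'} hf hf' := ⟨fun g v => by simp [hf.1, hf'.1], by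
    rintro _ ⟨v, rfl⟩
    exact add_mem (hf.2 ⟨v, rfl⟩) (hf'.2 ⟨v, rfl⟩)⟩
  smul_mem' c f hf := ⟨fun g v => by simp [hf.1], by
    rintro _ ⟨v, rfl⟩
    exact Submodule.smul_mem _ c (hf.2 ⟨v, rfl⟩)⟩

/-- Finite multiplicity of the finite-dimensional `α` makes the isotypical component
finite-dimensional. -/
theorem finiteDimensional_isotypic_of_equivariantHom {N : Submodule ℂ H}
    (h : FiniteDimensional ℂ (equivariantHom α U N)) :
    FiniteDimensional ℂ (isotypic α U N) := by
  have := α.finiteDimensional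
  -- the span of the values `f v`, with `f` equivariant, is finite-dimensional, hence closed
  let B : Submodule ℂ H := Submodule.map₂ LinearMap.id (equivariantHom α U N) ⊤
  have hB : FiniteDimensional ℂ B :=
    (Submodule.fg_iff_finiteDimensional _).1
      (((Submodule.fg_iff_finiteDimensional _).2 h).map₂ _ Module.Finite.fg_top)
  have hle : isotypic α U N ≤ B := by
    refine Submodule.topologicalClosure_minimal _ (iSup_le ?_) B.closed_of_finiteDimensional
    rintro ⟨f, hf⟩ _ ⟨v, rfl⟩
    exact Submodule.apply_mem_map₂ LinearMap.id (show f ∈ equivariantHom α U N from hf)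
      Submodule.mem_top
  exact Submodule.finiteDimensional_of_le hle

variable {α U}

theorem isotypic_mono {N N' : Submodule ℂ H} (h : N ≤ N') : isotypic α U N ≤ isotypic α U N' := by
  refine Submodule.topologicalClosure_mono (iSup_le ?_)
  rintro ⟨f, hf⟩
  exact le_iSup (fun f : {f : V →ₗ[ℂ] H // (∀ g v, f (α.rep g v) = U g (f v)) ∧
    LinearMap.range f ≤ N'} => LinearMap.range f.1) ⟨f, hf.1, hf.2.trans h⟩

theorem isotypic_le {N : Submodule ℂ H} (hN : IsClosed (N : Set H)) : isotypic α U N ≤ N :=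
  Submodule.topologicalClosure_minimal _ (iSup_le fun f => f.2.2) hN

theorem apply_mem_isotypic {N N' : Submodule ℂ H} {T : H →L[ℂ] H}
    (hT : ∀ g, T ∘L U g = U g ∘L T) (hN : ∀ u ∈ N, T u ∈ N') {u : H}
    (hu : u ∈ isotypic α U N) : T u ∈ isotypic α U N' := by
  have hle : isotypic α U N ≤ (isotypic α U N').comap T.toLinearMap := by
    refine Submodule.topologicalClosure_minimal _ (iSup_le ?_)
      ((Submodule.isClosed_topologicalClosure _).preimage T.continuous)
    rintro ⟨f, hf⟩ _ ⟨v, rfl⟩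
    refine Submodule.le_topologicalClosure _ ((le_iSup (fun f : {f : V →ₗ[ℂ] H //
      (∀ g v, f (α.rep g v) = U g (f v)) ∧ LinearMap.range f ≤ N'} => LinearMap.range f.1)
      ⟨T.toLinearMap ∘ₗ f, fun g v => ?_, ?_⟩) ⟨v, rfl⟩)
    · simp only [LinearMap.comp_apply, hf.1]
      exact DFunLike.congr_fun (hT g) (f v)
    · rintro _ ⟨w, rfl⟩
      exact hN _ (hf.2 ⟨w, rfl⟩)
  exact hle hu

theorem coe_isotypicOp [CompleteSpace H] {N : Submodule ℂ H} {T : H →L[ℂ] H}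
    (hT : ∀ g, T ∘L U g = U g ∘L T) (hN : ∀ u ∈ N, T u ∈ N) (u : isotypic α U N) :
    (isotypicOp α U N T u : H) = T u :=
  Submodule.starProjection_eq_self_iff.2 (apply_mem_isotypic hT hN u.2)

/-- Let `Q + Q' = 1`, where `Q'` is invariant and has values in a space with finite-dimensional
isotypical component. Then, for invariant `P`, `π_α(P)` differs from `π_α(Q P Q)` by an operator
of finite rank. -/
theorem isFredholm_isotypicOp_iff_cutoff [CompleteSpace H] {D : Submodule ℂ H}
    [FiniteDimensional ℂ (isotypic α U D)] {P Q Q' : H →L[ℂ] H}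
    (hP : ∀ g, P ∘L U g = U g ∘L P) (hQ' : ∀ g, Q' ∘L U g = U g ∘L Q')
    (hadd : Q + Q' = ContinuousLinearMap.id ℂ H) (hD : ∀ u, Q' u ∈ D) :
    (isotypicOp α U ⊤ P).IsFredholm ↔ (isotypicOp α U ⊤ (Q ∘L P ∘L Q)).IsFredholm := by
  let K := isotypic α U (⊤ : Submodule ℂ H)
  let p : H →ₗ[ℂ] K := K.orthogonalProjectionOnto.toLinearMap
  have hPK (u : K) : P u ∈ K := apply_mem_isotypic hP (fun _ _ => Submodule.mem_top) u.2
  have hQK {u : H} (hu : u ∈ K) : Q' u ∈ isotypic α U D :=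
    apply_mem_isotypic hQ' (fun u _ => hD u) hu
  -- `P - Q P Q = Q' P + Q P Q'`, where both terms factor through the finite-dimensional `D_α`
  let c : K →ₗ[ℂ] isotypic α U D :=
    (Q'.toLinearMap ∘ₗ K.subtype).codRestrict _ fun u => hQK u.2
  let c' : K →ₗ[ℂ] isotypic α U D :=
    (Q'.toLinearMap ∘ₗ P.toLinearMap ∘ₗ K.subtype).codRestrict _ fun u => hQK (hPK u)
  refine ContinuousLinearMap.isFredholm_congr_of_hasFiniteRange_sub ?_
  have heq : (isotypicOp α U ⊤ P).toLinearMap - (isotypicOp α U ⊤ (Q ∘L P ∘L Q)).toLinearMap =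
      (p ∘ₗ (isotypic α U D).subtype) ∘ₗ c' +
        (p ∘ₗ Q.toLinearMap ∘ₗ P.toLinearMap ∘ₗ (isotypic α U D).subtype) ∘ₗ c := by
    refine LinearMap.ext fun u => ?_
    have h1 (v : H) : Q v + Q' v = v := DFunLike.congr_fun hadd v
    have h2 : P u - Q (P (Q u)) = Q' (P u) + Q (P (Q' u)) := by
      have h3 : Q (P u) = Q (P (Q u)) + Q (P (Q' u)) := by rw [← map_add, ← map_add, h1]
      calc P u - Q (P (Q u)) = Q (P u) + Q' (P u) - Q (P (Q u)) := by rw [h1]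
        _ = Q' (P u) + Q (P (Q' u)) := by rw [h3]; abel
    change p (P u) - p (Q (P (Q u))) = p (Q' (P u)) + p (Q (P (Q' u)))
    rw [← map_sub, h2, map_add]
  rw [heq]
  exact (LinearMap.HasFiniteRange.of_finite_dom.comp_right _).add
    (LinearMap.HasFiniteRange.of_finite_dom.comp_right _)

/-- For invariant cut-offs `Q`, `Q'` with sum `1`, where `Q` projects onto the closed subspace `C`
and `Q'` has values in a space with finite-dimensional isotypical component, an operator `T` that
lives on `C` is Fredholm on the isotypical component of the whole space if and only if it is on
that of `C`. -/
theorem isFredholm_isotypicOp_iff_restrict [CompleteSpace H] {C D : Submodule ℂ H}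
    [FiniteDimensional ℂ (isotypic α U D)] {T Q Q' : H →L[ℂ] H}
    (hT : ∀ g, T ∘L U g = U g ∘L T) (hQ : ∀ g, Q ∘L U g = U g ∘L Q)
    (hQ' : ∀ g, Q' ∘L U g = U g ∘L Q') (hadd : Q + Q' = ContinuousLinearMap.id ℂ H)
    (hC : ∀ u, Q u ∈ C) (hC' : ∀ u ∈ C, Q u = u) (hC'' : IsClosed (C : Set H))
    (hD : ∀ u, Q' u ∈ D) (hTC : ∀ u, T u ∈ C) (hTQ : T ∘L Q = T) :
    (isotypicOp α U ⊤ T).IsFredholm ↔ (isotypicOp α U C T).IsFredholm := by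
  let K := isotypic α U (⊤ : Submodule ℂ H)
  let i : isotypic α U C →L[ℂ] K :=
    (isotypic α U C).subtypeL.codRestrict K fun u => isotypic_mono le_top u.2
  let p : K →L[ℂ] isotypic α U C :=
    (Q ∘L K.subtypeL).codRestrict _ fun u => apply_mem_isotypic hQ (fun u _ => hC u) u.2
  let c : K →ₗ[ℂ] isotypic α U D := (Q'.toLinearMap ∘ₗ K.subtype).codRestrict _ fun u =>
    apply_mem_isotypic hQ' (fun u _ => hD u) u.2
  let j : isotypic α U D →ₗ[ℂ] K :=
    (isotypic α U D).subtype.codRestrict K fun u => isotypic_mono le_top u.2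
  have hfac : isotypicOp α U ⊤ T = i ∘L isotypicOp α U C T ∘L p := by
    ext u
    rw [coe_isotypicOp hT (fun _ _ => Submodule.mem_top)]
    change T u = (isotypicOp α U C T (p u) : H)
    rw [coe_isotypicOp hT (fun u _ => hTC u)]
    exact (DFunLike.congr_fun hTQ (u : H)).symm
  have hsub : LinearMap.id - i.toLinearMap ∘ₗ p.toLinearMap = j ∘ₗ c := by
    refine LinearMap.ext fun u => Subtype.ext ?_
    change (u : H) - Q u = Q' u
    exact sub_eq_of_eq_add' (DFunLike.congr_fun hadd (u : H)).symm
  rw [hfac]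
  refine ContinuousLinearMap.isFredholm_comp_iff (fun y => Subtype.ext ?_) ?_ _
  · exact hC' _ (isotypic_le hC'' y.2)
  · rw [hsub]
    exact LinearMap.HasFiniteRange.of_finite_dom.comp_right _

end Isotypic

section OrbitsCover

variable {M : Type*} [TopologicalSpace M] [CompactSpace M] [T2Space M]
  [MeasurableSpace M] [BorelSpace M]
  {μ : Measure M} [IsFiniteMeasure μ]
  {F : Type*} [NormedAddCommGroup F] [NormedSpace ℂ F]
  {E : M → Type*} [∀ x, NormedAddCommGroup (E x)] [∀ x, InnerProductSpace ℂ (E x)]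
  [TopologicalSpace (TotalSpace F E)] [FiberBundle F E] [VectorBundle ℂ F E]
  [IsHermitianBundle F E]
  {G : Type*} [Group G] [TopologicalSpace G] [IsTopologicalGroup G] [CompactSpace G]
  [SecondCountableTopology G]
  [MulAction G M] [ContinuousSMul G M]
  (σ : HermitianAction G F E)

/-- A section over a set covered by finitely many orbits is controlled by its pull-backs along
the orbit maps. -/
theorem norm_sq_mulOp_clopenChar_le [MeasurableSpace G] [BorelSpace G] [∀ x, CompleteSpace (E x)]
    {S : Set M} (hS : IsClopen S) {T : Finset M} (hT : S ⊆ ⋃ x ∈ T, MulAction.orbit G x)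
    {ν : M → Measure G} [∀ x, IsFiniteMeasure (ν x)]
    (hν : ∀ x, MeasurePreserving (fun h : G => h • x) (ν x) (μ.restrict (MulAction.orbit G x)))
    (u : L2 μ F E) :
    ‖mulOp μ (clopenChar hS) u‖ ^ 2 ≤ ∑ x ∈ T, ‖pullbackOp σ (hν x) u‖ ^ 2 := by
  induction u using UniformSpace.Completion.induction_on with
  | hp =>
    refine isClosed_le ((mulOp μ (clopenChar hS)).continuous.norm.pow 2) ?_
    exact continuous_finsetSum _ fun x _ => (pullbackOp σ (hν x)).continuous.norm.pow 2
  | ih s =>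
    have hO (x : M) : MeasurableSet (MulAction.orbit G x) :=
      (isCompact_range (continuous_id.smul continuous_const :
        Continuous fun h : G => h • x)).isClosed.measurableSet
    have hint := PreL2.integrable_norm_sq s
    simp only [mulOp_coe, UniformSpace.Completion.norm_coe, pullbackOp_coe,
      fun x => norm_sq_toLp_pullbackFun σ (hν x) s, PreL2.norm_sq_eq]
    simp only [← integral_indicator (hO _)]
    rw [← integral_finsetSum _ fun x _ => hint.indicator (hO x)]
    refine integral_mono (PreL2.integrable_norm_sq _)
      (integrable_finsetSum _ fun x _ => hint.indicator (hO x)) fun y => ?_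
    have hnn (x : M) (_ : x ∈ T) :
        0 ≤ (MulAction.orbit G x).indicator (fun y => ‖s.toFun y‖ ^ 2) y :=
      Set.indicator_nonneg (fun _ _ => by positivity) _
    change ‖(PreL2.mul (clopenChar hS) s).toFun y‖ ^ 2 ≤ _
    rw [PreL2.toFun_mul]
    by_cases hy : y ∈ S
    · obtain ⟨x, hxT, hyx⟩ := Set.mem_iUnion₂.1 (hT hy)
      refine le_trans ?_ (Finset.single_le_sum hnn hxT)
      rw [clopenChar_of_mem hS hy, one_smul, Set.indicator_of_mem hyx]
    · rw [clopenChar_of_notMem hS hy, zero_smul, norm_zero, zero_pow two_ne_zero]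
      exact Finset.sum_nonneg hnn

/-- Over finitely many orbits every irreducible representation has finite multiplicity: the
pull-backs embed equivariant maps into `L²(M, E)` into finitely many spaces of equivariant maps
into `L²(G, E x)`. -/
theorem finiteDimensional_isotypic_of_orbits_cover [FiniteDimensional ℂ F]
    [SecondCountableTopology M] [SMulInvariantMeasure G M μ] {S : Set M} (hS : IsClopen S)
    {T : Finset M} (hT : S ⊆ ⋃ x ∈ T, MulAction.orbit G x)
    {V : Type*} [NormedAddCommGroup V] [InnerProductSpace ℂ V] (α : UnitaryIrrep G V) :
    FiniteDimensional ℂ (isotypic α (translateOp μ σ) (L2On μ S)) := by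
  have hE (x : M) : FiniteDimensional ℂ (E x) :=
    (((trivializationAt F E x).linearEquivAt ℂ x
      (mem_baseSet_trivializationAt F E x)).symm).finiteDimensional
  have hE' (x : M) : CompleteSpace (E x) := FiniteDimensional.complete ℂ (E x)
  borelize G
  choose ν hfin hinv hν using exists_measurePreserving_orbit (G := G) μ
  refine finiteDimensional_isotypic_of_equivariantHom α _ ?_
  have (x : M) := finiteDimensional_regularHom (W := E x) α (ν x)
  let Φ : equivariantHom α (translateOp μ σ) (L2On μ S) →ₗ[ℂ]
      ((x : T) → regularHom α (E x) (ν x)) :=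
    LinearMap.pi fun x => LinearMap.codRestrict _
      (LinearMap.compRight ℂ (pullbackOp σ (hν x)).toLinearMap ∘ₗ Submodule.subtype _)
      fun f g v => by
        change pullbackOp σ (hν x) (f.1 (α.rep g v)) = _
        rw [f.2.1 g v]
        exact pullbackOp_translateOp σ (hν x) g (f.1 v)
  refine FiniteDimensional.of_injective Φ ((injective_iff_map_eq_zero _).2 fun f hf => ?_)
  refine Subtype.ext (LinearMap.ext fun v => ?_)
  have hmem : f.1 v ∈ L2On μ S := f.2.2 ⟨v, rfl⟩
  have hle := norm_sq_mulOp_clopenChar_le σ hS hT hν (f.1 v)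
  rw [mulOp_clopenChar_of_mem hS hmem] at hle
  have hzero : ∑ x ∈ T, ‖pullbackOp σ (hν x) (f.1 v)‖ ^ 2 = 0 := by
    refine Finset.sum_eq_zero fun x hx => ?_
    have h1 : pullbackOp σ (hν x) (f.1 v) = 0 :=
      DFunLike.congr_fun (congrArg Subtype.val (congrFun hf ⟨x, hx⟩)) v
    rw [h1, norm_zero, zero_pow two_ne_zero]
  rw [hzero] at hle
  exact norm_eq_zero.1 (pow_eq_zero_iff two_ne_zero |>.1 (le_antisymm hle (by positivity)))

end OrbitsCover

theorem mainTheorem9 {d n : ℕ}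
    -- a compact Lie group `G`
    {G : Type*} [Group G] [TopologicalSpace G] [ChartedSpace (EuclideanSpace ℝ (Fin d)) G]
    [LieGroup (𝓡 d) ∞ G] [CompactSpace G] [T2Space G]
    -- a closed Riemannian manifold `M`
    {M : Type*} [EMetricSpace M] [ChartedSpace (EuclideanSpace ℝ (Fin n)) M]
    [IsManifold (𝓡 n) ∞ M] [RiemannianBundle (fun x : M => TangentSpace (𝓡 n) x)]
    [IsContMDiffRiemannianBundle (𝓡 n) ∞ (EuclideanSpace ℝ (Fin n))
      (fun x : M => TangentSpace (𝓡 n) x)]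
    [IsRiemannianManifold (𝓡 n) M] [CompactSpace M] [MeasurableSpace M] [BorelSpace M]
    -- a smooth isometric action of `G` on `M`
    [MulAction G M] [ContMDiffSMul (𝓡 d) (𝓡 n) ∞ G M] [IsIsometricSMul G M]
    -- a `G`-equivariant Hermitian vector bundle `E` on `M`
    {F : Type*} [NormedAddCommGroup F] [NormedSpace ℂ F] [FiniteDimensional ℂ F]
    {E : M → Type*} [∀ x, NormedAddCommGroup (E x)] [∀ x, InnerProductSpace ℂ (E x)]
    [TopologicalSpace (TotalSpace F E)] [FiberBundle F E] [VectorBundle ℂ F E]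
    [IsHermitianBundle F E] (σ : HermitianAction G F E) :
    ∃ hP : IsClopen (pathologicalSet d n G M),
      let Ptl : Set M := pathologicalSet d n G M
      let μ : Measure M := riemannianVolume n M
      let Mχ : L2 μ F E →L[ℂ] L2 μ F E := mulOp μ (clopenChar hP.compl)
      let Mχ' : L2 μ F E →L[ℂ] L2 μ F E := mulOp μ (1 - clopenChar hP.compl)
      ∀ P ∈ PsiAlg (F := F) (E := E) μ,
        let P₁ := Mχ ∘L P ∘L Mχ
        let P₂ := Mχ' ∘L P ∘L Mχ'
        let P₃ := Mχ ∘L P ∘L Mχ' + Mχ' ∘L P ∘L Mχ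
        (P = P₁ + P₂ + P₃ ∧ P₁ ∈ PsiAlgOn μ Ptlᶜ ∧ P₂ ∈ PsiAlgOn μ Ptl ∧ IsCompactOperator P₃) ∧
        (P ∈ invariantOps μ σ →
          P₁ ∈ invariantOps μ σ ∧ P₂ ∈ invariantOps μ σ ∧
          ∀ {V : Type*} [NormedAddCommGroup V] [InnerProductSpace ℂ V] (α : UnitaryIrrep G V),
            -- the `α`-isotypical component of `L²(𝒫, E)` is finite-dimensional
            FiniteDimensional ℂ (isotypic α (translateOp μ σ) (L2On μ Ptl)) ∧
            -- `π_α(P₂)` is Fredholm on `L²(𝒫, E)_α`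
            (isotypicOp α (translateOp μ σ) (L2On μ Ptl) P₂).IsFredholm ∧
            -- `π_α(P)` is Fredholm on `ℋ_α` iff `π_α(P₁)` is, on `ℋ_α` or on `L²(M ∖ 𝒫, E)_α`
            ((isotypicOp α (translateOp μ σ) ⊤ P).IsFredholm ↔
              (isotypicOp α (translateOp μ σ) ⊤ P₁).IsFredholm) ∧
            ((isotypicOp α (translateOp μ σ) ⊤ P).IsFredholm ↔
              (isotypicOp α (translateOp μ σ) (L2On μ Ptlᶜ) P₁).IsFredholm)) := by
  have hP : IsClopen (pathologicalSet d n G M) := isClopen_pathologicalSet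
  refine ⟨hP, ?_⟩
  intro Ptl μ Mχ Mχ' P hPsi P₁ P₂ P₃
  have : IsTopologicalGroup G := topologicalGroup_of_lieGroup (𝓡 d) ∞
  have : ContinuousSMul G M := ContMDiffSMul.continuousSMul (I := 𝓡 d) (I' := 𝓡 n) ∞
  have : SecondCountableTopology G :=
    ChartedSpace.secondCountable_of_sigmaCompact (EuclideanSpace ℝ (Fin d)) G
  have : SecondCountableTopology M :=
    ChartedSpace.secondCountable_of_sigmaCompact (EuclideanSpace ℝ (Fin n)) M
  have hMχ' : Mχ' = mulOp μ (clopenChar hP) := by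
    rw [← one_sub_clopenChar_compl hP]
  have hadd : Mχ + Mχ' = ContinuousLinearMap.id ℂ _ := by
    rw [hMχ']
    exact mulOp_clopenChar_add hP
  -- the cut-offs are invariant because the pathological set is
  have hinv (g : G) (x : M) : g • x ∈ pathologicalSet d n G M ↔ x ∈ pathologicalSet d n G M :=
    smul_mem_pathologicalSet_iff g
  have hQ : Mχ ∈ invariantOps μ σ := fun g =>
    mulOp_comp_translateOp σ (clopenChar_smul hP.compl fun g x => not_congr (hinv g x)) g
  have hQ' : Mχ' ∈ invariantOps μ σ := fun g => by
    rw [hMχ']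
    exact mulOp_comp_translateOp σ (clopenChar_smul hP hinv) g
  refine ⟨⟨?_, cutoff_mem_PsiAlgOn hP.compl hPsi, ?_, ?_⟩, fun hPinv => ⟨?_, ?_, ?_⟩⟩
  · have h1 (u) : Mχ u + Mχ' u = u := DFunLike.congr_fun hadd u
    ext u
    change P u = Mχ (P (Mχ u)) + Mχ' (P (Mχ' u)) + (Mχ (P (Mχ' u)) + Mχ' (P (Mχ u)))
    calc P u = Mχ (P (Mχ u + Mχ' u)) + Mχ' (P (Mχ u + Mχ' u)) := by rw [h1, h1]
      _ = _ := by simp only [map_add]; abel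
  · simp only [P₂, hMχ']
    exact cutoff_mem_PsiAlgOn hP hPsi
  · simp only [P₃, hMχ']
    exact (hPsi _ _ (disjoint_tsupport_clopenChar hP)).add
      (hPsi _ _ (disjoint_tsupport_clopenChar hP).symm)
  · exact comp_mem_invariantOps σ hQ (comp_mem_invariantOps σ hPinv hQ)
  · exact comp_mem_invariantOps σ hQ' (comp_mem_invariantOps σ hPinv hQ')
  · intro V _ _ α
    obtain ⟨T, hT⟩ := exists_finset_orbits_cover (d := d) (n := n) (G := G) (M := M)
    have hfin : FiniteDimensional ℂ (isotypic α (translateOp μ σ) (L2On μ Ptl)) :=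
      finiteDimensional_isotypic_of_orbits_cover σ hP hT α
    have hD (u) : Mχ' u ∈ L2On μ Ptl := by
      rw [hMχ']
      exact mulOp_clopenChar_mem hP u
    have hiff := isFredholm_isotypicOp_iff_cutoff (α := α) hPinv hQ' hadd hD
    refine ⟨hfin, ContinuousLinearMap.isFredholm_of_finiteDimensional _, hiff, hiff.trans ?_⟩
    have hidem : Mχ ∘L Mχ = Mχ := by
      ext u
      exact mulOp_clopenChar_of_mem hP.compl (mulOp_clopenChar_mem hP.compl u)
    refine isFredholm_isotypicOp_iff_restrict (α := α) (Q := Mχ)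
      (comp_mem_invariantOps σ hQ (comp_mem_invariantOps σ hPinv hQ)) hQ hQ' hadd
      (mulOp_clopenChar_mem hP.compl) (fun u => mulOp_clopenChar_of_mem hP.compl)
      (isClosed_L2On _) hD (fun u => ?_) ?_
    · exact mulOp_clopenChar_mem hP.compl _
    · rw [ContinuousLinearMap.comp_assoc, ContinuousLinearMap.comp_assoc, hidem]
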